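/- Theorem 1.2. Let $n\ge 2$. Define the following spaces, where spaces of polynomials carry the topology given by their coefficients and quotients carry the quotient topology. - $C_n$ is the space of monic complex polynomials of degree $n$ with $n$ distinct roots (equivalently, of sets of $n$ distinct points of $\mathbb{C}$). - $Z_n\subset C_n$ is the subspace of those $f\in C_n$ that have constant term $0$ and $n-1$ distinct non-zero critical values. - $V_n=\{(v_1,\dots,v_{n-1})\in(\mathbb{C}\setminus\{0\})^{n-1}: v_i\ne v_j \text{ if } i\ne j\}/S_{n-1}$. - $D_n=\{(z_1,\dots,z_n)\in\mathbb{C}^n: z_i\ne z_j\text{ if } i\ne j\}/S_{n-1}$, where $S_{n-1}$ permutes the last $n-1$ entries. Let $\theta_n:Z_n\to V_n$ send a polynomial to its set of critical values, and let $p:D_n\to C_n$ send $(z_1,\dots,z_n)$ to $\prod_{i=1}^n(z-z_i)$. Put $Z_n^1=Z_n$ and, for $j\ge1$, let $Z_n^{j+1}$ be the space of those $f\in Z_n$, with critical values $v_1,\dots,v_{n-1}$, for which the polynomial $z\prod_{i=1}^{n-1}(z-v_i)$ lies in $Z_n^j$. The map $Z_n^{j+1}\to Z_n^j$, $f\mapsto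 z\prod_{i=1}^{n-1}(z-v_i)$, is again denoted by $\theta_n$. Then in the infinite tower $$\cdots\to Z_n^{j+1}\xrightarrow{\theta_n} Z_n^{j}\to\cdots\to Z_n^2\xrightarrow{\theta_n} Z_n^1=Z_n\xrightarrow{\theta_n}V_n\simeq D_n\xrightarrow{p}C_n$$ the map $\theta_n:Z_n\to V_n$ and every map $\theta_n:Z_n^{j+1}\to Z_n^j$, $j\ge1$, is a covering map of degree $n^{n-1}$, the spaces $V_n$ and $D_n$ are homotopy equivalent, and $p$ is a covering map of degree $n$. -/

import Mathlib

namespace CriticalTower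

open Polynomial

/-- The topology of coefficientwise convergence on complex polynomials. On the monic polynomials of
a fixed degree `n`, it is the usual topology of the coefficient space `ℂ ^ n`. -/
noncomputable instance polynomialTopology : TopologicalSpace ℂ[X] :=
  TopologicalSpace.induced (fun f : ℂ[X] => fun i : ℕ => f.coeff i) inferInstance

/-- A covering map all of whose fibres have exactly `d` points (used for `d ≥ 1` only). -/
def IsCoveringMapOfDegree {E B : Type*} [TopologicalSpace E] [TopologicalSpace B]
    (f : E → B) (d : ℕ) : Prop :=
  IsCoveringMap f ∧ ∀ b : B, Nat.card (f ⁻¹' {b}) = d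

/-! ### Polynomials -/

/-- `C_n`, as a set: monic complex polynomials of degree `n` with `n` distinct roots. -/
def polyC (n : ℕ) : Set ℂ[X] :=
  {f | f.Monic ∧ f.natDegree = n ∧ {z : ℂ | f.IsRoot z}.ncard = n}

/-- The set of critical values of `f`. -/
def criticalValues (f : ℂ[X]) : Set ℂ :=
  (fun c : ℂ => f.eval c) '' {c : ℂ | f.derivative.IsRoot c}

/-- `Z_n`, as a set: the polynomials in `C_n` that have constant term `0` and `n - 1` distinct
critical values, all of them non-zero. -/
def polyZ (n : ℕ) : Set ℂ[X] :=
  {f | f ∈ polyC n ∧ f.coeff 0 = 0 ∧ (criticalValues f).ncard = n - 1 ∧ 0 ∉ criticalValues f}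

/-! ### Configuration spaces -/

/-- Ordered `(n - 1)`-tuples of distinct non-zero complex numbers. -/
def OrdV (n : ℕ) : Type :=
  {v : Fin (n - 1) → ℂ // Function.Injective v ∧ ∀ i, v i ≠ 0}

instance (n : ℕ) : TopologicalSpace (OrdV n) :=
  inferInstanceAs (TopologicalSpace {v : Fin (n - 1) → ℂ // Function.Injective v ∧ ∀ i, v i ≠ 0})

/-- Two tuples are related if they differ by a permutation of the entries. -/
def permV (n : ℕ) : Setoid (OrdV n) where
  r v w := ∃ σ : Equiv.Perm (Fin (n - 1)), w.1 = v.1 ∘ σ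
  iseqv :=
    { refl := fun _ => ⟨1, rfl⟩
      symm := by
        rintro v w ⟨σ, h⟩
        refine ⟨σ⁻¹, ?_⟩
        rw [h]
        funext i
        simp
      trans := by
        rintro u v w ⟨σ, h⟩ ⟨τ, h'⟩
        exact ⟨σ * τ, by rw [h', h]; rfl⟩ }

/-- `V_n`: unordered `(n - 1)`-tuples of distinct non-zero complex numbers, with the quotient
topology. -/
def V (n : ℕ) : Type := Quotient (permV n)

instance (n : ℕ) : TopologicalSpace (V n) :=
  inferInstanceAs (TopologicalSpace (Quotient (permV n)))

/-- Ordered `n`-tuples of distinct complex numbers. -/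
def OrdD (n : ℕ) : Type := {z : Fin n → ℂ // Function.Injective z}

instance (n : ℕ) : TopologicalSpace (OrdD n) :=
  inferInstanceAs (TopologicalSpace {z : Fin n → ℂ // Function.Injective z})

/-- Two tuples are related if they differ by a permutation of the last `n - 1` entries, that is,
a permutation of all entries that fixes the first index. -/
def permD (n : ℕ) : Setoid (OrdD n) where
  r z w := ∃ σ : Equiv.Perm (Fin n), (∀ i : Fin n, i.val = 0 → σ i = i) ∧ w.1 = z.1 ∘ σ
  iseqv :=
    { refl := fun _ => ⟨1, fun _ _ => rfl, rfl⟩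
      symm := by
        rintro v w ⟨σ, h0, h⟩
        refine ⟨σ⁻¹, fun i hi => ?_, ?_⟩
        · rw [Equiv.Perm.inv_eq_iff_eq]
          exact (h0 i hi).symm
        · rw [h]
          funext i
          simp
      trans := by
        rintro u v w ⟨σ, h0, h⟩ ⟨τ, h0', h'⟩
        refine ⟨σ * τ, fun i hi => ?_, by rw [h', h]; rfl⟩
        rw [Equiv.Perm.mul_apply, h0' i hi, h0 i hi] }

/-- `D_n`: `n`-tuples of distinct complex numbers, the last `n - 1` of them unordered, with the
quotient topology. -/
def D (n : ℕ) : Type := Quotient (permD n)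

instance (n : ℕ) : TopologicalSpace (D n) :=
  inferInstanceAs (TopologicalSpace (Quotient (permD n)))

/-! ### The critical-value map -/

/-- The set of `n - 1` complex numbers that a point of `V_n` consists of. -/
def V.points {n : ℕ} (v : V n) : Set ℂ :=
  Quotient.lift (s := permV n) (fun w : OrdV n => Set.range w.1)
    (by
      rintro a b ⟨σ, h⟩
      show Set.range a.1 = Set.range b.1
      rw [h, σ.surjective.range_comp]) v

theorem V.points_injective (n : ℕ) : Function.Injective (V.points (n := n)) := by
  intro v w
  refine Quotient.inductionOn₂ v w fun a b h => ?_
  have h : Set.range a.1 = Set.range b.1 := h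
  refine Quotient.sound ?_
  refine ⟨(Equiv.ofInjective b.1 b.2.1).trans
    ((Equiv.setCongr h.symm).trans (Equiv.ofInjective a.1 a.2.1).symm), ?_⟩
  funext i
  simp only [Function.comp_apply, Equiv.trans_apply]
  rw [Equiv.apply_ofInjective_symm a.2.1]
  rfl

theorem exists_points_eq {n : ℕ} {f : ℂ[X]} (hf : f ∈ polyZ n) :
    ∃ v : V n, v.points = criticalValues f := by
  obtain ⟨⟨hm, hd, -⟩, h0, hc, hz⟩ := hf
  have hdeg : f.natDegree ≠ 0 := by
    intro h
    rw [Monic.natDegree_eq_zero hm] at h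
    rw [h] at h0
    simp at h0
  have hder : f.derivative ≠ 0 := by
    intro h
    exact hdeg (derivative_eq_zero.mp h)
  have hfin : (criticalValues f).Finite := (finite_setOfPred_isRoot hder).image _
  have := hfin.fintype
  have hcard : Fintype.card (criticalValues f) = n - 1 := by
    rw [← hc, Set.ncard_eq_toFinset_card', Set.toFinset_card]
  let e := (Fintype.equivFinOfCardEq hcard).symm
  refine ⟨Quotient.mk (permV n) ⟨fun i => (e i).1,
    Subtype.val_injective.comp e.injective, fun i hi => hz (hi ▸ (e i).2)⟩, ?_⟩
  show Set.range (fun i => (e i).1) = criticalValues f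
  ext x
  constructor
  · rintro ⟨i, rfl⟩
    exact (e i).2
  · intro hx
    exact ⟨e.symm ⟨x, hx⟩, by simp⟩

/-- The map `θ_n : Z_n → V_n` that sends a polynomial to its set of critical values. -/
noncomputable def theta (n : ℕ) (f : polyZ n) : V n :=
  Classical.choose (exists_points_eq f.2)

theorem theta_points (n : ℕ) (f : polyZ n) : (theta n f).points = criticalValues f.1 :=
  Classical.choose_spec (exists_points_eq f.2)

/-! ### The tower -/

/-- The polynomial `z * ∏ i, (z - v_i)` of a point of `V_n`. -/
noncomputable def V.toPoly {n : ℕ} (v : V n) : ℂ[X] :=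
  Quotient.lift (s := permV n) (fun w : OrdV n => X * ∏ i, (X - C (w.1 i)))
    (by
      rintro a b ⟨σ, h⟩
      show X * ∏ i, (X - C (a.1 i)) = X * ∏ i, (X - C (b.1 i))
      rw [h]
      exact congrArg (X * ·) (Equiv.prod_comp σ (fun i => X - C (a.1 i))).symm) v

/-- `towerZ n j` is the set `Z_n^{j+1}`: the first floor is `Z_n`, and each next one consists of
the `f ∈ Z_n` such that the polynomial with roots `0` and the critical values of `f` lies in the
floor below. -/
def towerZ (n : ℕ) : ℕ → Set ℂ[X]
  | 0 => polyZ n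
  | j + 1 => {f | ∃ hf : f ∈ polyZ n, (theta n ⟨f, hf⟩).toPoly ∈ towerZ n j}

/-- The map `Z_n^{j+2} → Z_n^{j+1}` of the tower: `f` goes to the polynomial whose roots are `0`
and the critical values of `f`. -/
noncomputable def towerMap (n j : ℕ) (f : towerZ n (j + 1)) : towerZ n j :=
  ⟨(theta n ⟨f.1, f.2.1⟩).toPoly, f.2.2⟩

/-! ### Forgetting the marked point -/

theorem prod_mem_polyC {n : ℕ} (z : OrdD n) : ∏ i, (X - C (z.1 i)) ∈ polyC n := by
  refine ⟨monic_prod_of_monic _ _ fun i _ => monic_X_sub_C _, by simp, ?_⟩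
  have : {x : ℂ | (∏ i, (X - C (z.1 i))).IsRoot x} = Set.range z.1 := by
    ext x
    simp only [Set.mem_ofPred_eq, IsRoot.def, eval_prod, Finset.prod_eq_zero_iff, Finset.mem_univ,
      true_and, eval_sub, eval_X, eval_C, sub_eq_zero, Set.mem_range]
    exact exists_congr fun i => eq_comm
  rw [this, ← Set.image_univ, Set.ncard_image_of_injective _ z.2, Set.ncard_univ, Nat.card_fin]

/-- The map `p : D_n → C_n` that forgets which point is the first one; a set of `n` distinct points
is regarded as the monic polynomial with these roots. -/
noncomputable def forget (n : ℕ) (z : D n) : polyC n :=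
  Quotient.lift (s := permD n)
    (fun w : OrdD n => (⟨∏ i, (X - C (w.1 i)), prod_mem_polyC w⟩ : polyC n))
    (by
      rintro a b ⟨σ, -, h⟩
      refine Subtype.ext ?_
      show ∏ i, (X - C (a.1 i)) = ∏ i, (X - C (b.1 i))
      rw [h]
      exact (Equiv.prod_comp σ (fun i => X - C (a.1 i))).symm) z

end CriticalTower

/-!
The map `θ_n` becomes a polynomial map after ordering critical points and critical values. A monic
polynomial `f` of degree `n` with constant term `0` is determined by its critical points `c`, as
`f' = n * ∏ l, (X - c l)` (`critPoly`), and its critical values are `n - 1` homogeneous polynomials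
of degree `n` in the `n - 1` variables `c` (`critValue`). This map `F` from `ℂ ^ (n - 1)` to itself
has the following properties.

* `F c = 0` only for `c = 0` (`eq_zero_of_polyMap_critValue_eq_zero`): otherwise `f` would have too
  many multiple roots. Hence `F` is proper.
* The Jacobian of `F` is invertible wherever the critical values are distinct and non-zero
  (`nondegenerate_critValue`): a kernel vector gives a polynomial of degree less than `n` with the
  `n` roots `0, c 0, …, c (n - 2)`.

So `F` is a finite covering over the space of ordered configurations, and dividing by the
permutations gives the covering property of `θ_n`. Its degree `n ^ (n - 1)` is Bézout's number
(`MvPoly.card_fiber_polyMap`). Bézout's theorem is proved for a homogeneous map `P` of degree `d` in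
`m` variables without nontrivial zeros, by comparing dimensions of spaces of polynomials, where `k`
is the number of points over a regular value `v`.

* Polynomials dual to these `k` points are linearly independent over the polynomials in `P`, so that
  `k * (K + m).choose m ≤ (d * K + D + m).choose m` for a constant `D` and all `K`.
* A polynomial `a` of degree at most `d * K` that vanishes to order `K + 1` at the `k` points is zero:
  on a complex line through `v`, the product of the values of `a` over the fibres vanishes to order
  `k * (K + 1)` at `v` but grows at most like the power `k * K` of the parameter, so it vanishes by
  the theorems of Riemann and Liouville. Therefore
  `(d * K + m).choose m ≤ k * (K + m).choose m` for all `K`.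

For `K → ∞` this gives `k = d ^ m`.

The maps of the tower are pullbacks of `θ_n` along the map that sends a polynomial `X * g` to the set
of roots of `g`; it is continuous because the map from roots to coefficients is proper
(`isProperMap_rootPoly`). The same fact gives local orderings of the roots of a polynomial in `C_n`,
and the sheets of `D_n → C_n` are the choices of one of the `n` roots. Finally `V_n` is the part of
`D_n` where the marked point is `0`, and translation contracts `D_n` onto it.
-/

namespace CriticalTower

open Topology Filter

/-! ### Covering maps from local sections -/

/-- A family of continuous sections of `f` over `U` that passes through each point of `f ⁻¹' U`
exactly once. -/
structure IsSheetFamily {E B ι : Type*} [TopologicalSpace E] [TopologicalSpace B]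
    (f : E → B) (U : Set B) (s : ι → U → E) : Prop where
  continuous : ∀ i, Continuous (s i)
  apply : ∀ i u, f (s i u) = u
  injective : ∀ u, Function.Injective fun i => s i u
  exhaustive : ∀ e (h : f e ∈ U), ∃ i, s i ⟨f e, h⟩ = e

namespace IsSheetFamily

variable {E B ι : Type*} [TopologicalSpace E] [TopologicalSpace B] {f : E → B} {U : Set B}
  {s : ι → U → E}

theorem bijective (h : IsSheetFamily f U s) {b : B} (hb : b ∈ U) :
    Function.Bijective fun i => (⟨s i ⟨b, hb⟩, h.apply i ⟨b, hb⟩⟩ : f ⁻¹' {b}) := by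
  refine ⟨fun i j hij => h.injective ⟨b, hb⟩ (congrArg Subtype.val hij), ?_⟩
  rintro ⟨e, rfl⟩
  obtain ⟨i, hi⟩ := h.exhaustive e hb
  exact ⟨i, Subtype.ext hi⟩

theorem card_fiber (h : IsSheetFamily f U s) {b : B} (hb : b ∈ U) :
    Nat.card (f ⁻¹' {b}) = Nat.card ι :=
  (Nat.card_eq_of_bijective _ (h.bijective hb)).symm

/-- If `E` is Hausdorff, the finitely many sheets are closed in `f ⁻¹' U`; being a finite partition,
they are open as well. -/
theorem isEvenlyCovered [T2Space E] [Finite ι] (hf : Continuous f) (hU : IsOpen U)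
    (h : IsSheetFamily f U s) {b : B} (hb : b ∈ U) : IsEvenlyCovered f b (f ⁻¹' {b}) := by
  let _ : TopologicalSpace ι := ⊥
  have : DiscreteTopology ι := ⟨rfl⟩
  refine IsEvenlyCovered.to_isEvenlyCovered_preimage (I := ι)
    ⟨inferInstance, U, hb, hU, hU.preimage hf, ?_⟩
  let g : U × ι ≃ f ⁻¹' U := Equiv.ofBijective
    (fun p => ⟨s p.2 p.1, by rw [Set.mem_preimage, h.apply]; exact p.1.2⟩) (by
      constructor
      · rintro ⟨u, i⟩ ⟨u', i'⟩ hp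
        have hp : s i u = s i' u' := congrArg Subtype.val hp
        have hu : u = u' := Subtype.ext (by rw [← h.apply i u, hp, h.apply])
        subst hu
        rw [h.injective u hp]
      · rintro ⟨e, he⟩
        obtain ⟨i, hi⟩ := h.exhaustive e he
        exact ⟨(⟨f e, he⟩, i), Subtype.ext hi⟩)
  have hg : Continuous g := by
    refine Continuous.subtype_mk (continuous_prod_of_discrete_right.mpr fun i => h.continuous i) _
  have hclosed : IsClosedMap g := by
    intro A hA
    have hi : ∀ i : ι, IsClosed {e : f ⁻¹' U | s i ⟨f e.1, e.2⟩ = e.1 ∧ (⟨f e.1, e.2⟩, i) ∈ A} := by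
      intro i
      have hc : Continuous fun e : f ⁻¹' U => (⟨f e.1, e.2⟩ : U) :=
        Continuous.subtype_mk (hf.comp continuous_subtype_val) _
      exact (isClosed_eq ((h.continuous i).comp hc) continuous_subtype_val).inter
        (hA.preimage (hc.prodMk continuous_const))
    convert! isClosed_iUnion_of_finite hi using 1
    ext e
    simp only [Set.mem_image, Set.mem_iUnion, Set.mem_ofPred_eq]
    constructor
    · rintro ⟨⟨u, i⟩, hp, rfl⟩
      have hu : (⟨f (g (u, i)).1, (g (u, i)).2⟩ : U) = u := Subtype.ext (h.apply i u)
      exact ⟨i, by rw [hu]; rfl, by rw [hu]; exact hp⟩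
    · rintro ⟨i, hi, hp⟩
      exact ⟨_, hp, Subtype.ext hi⟩
  refine ⟨(g.toHomeomorphOfContinuousClosed hg hclosed).symm, fun e => ?_⟩
  obtain ⟨⟨u, i⟩, rfl⟩ := g.surjective e
  have : (g.toHomeomorphOfContinuousClosed hg hclosed).symm (g (u, i)) = (u, i) :=
    g.symm_apply_apply _
  rw [this]
  exact (h.apply i u).symm

end IsSheetFamily

theorem isCoveringMapOfDegree_of_sheets {E B : Type*} [TopologicalSpace E] [TopologicalSpace B]
    [T2Space E] {f : E → B} (hf : Continuous f) {d : ℕ} (hd : d ≠ 0)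
    (h : ∀ b, ∃ U : Set B, IsOpen U ∧ b ∈ U ∧ ∃ (ι : Type) (s : ι → U → E),
      Nat.card ι = d ∧ IsSheetFamily f U s) : IsCoveringMapOfDegree f d := by
  refine ⟨fun b => ?_, fun b => ?_⟩ <;> obtain ⟨U, hU, hb, ι, s, hι, hs⟩ := h b
  · have : Finite ι := Nat.finite_of_card_ne_zero (hι ▸ hd)
    exact hs.isEvenlyCovered hf hU hb
  · rw [hs.card_fiber hb, hι]

/-- Inverse branches of a proper local homeomorphism near a point of the base. -/
theorem exists_inverse_branches {E B : Type*} [TopologicalSpace E] [TopologicalSpace B] [T2Space E]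
    [T1Space B] {F : E → B} (hF : IsProperMap F) (v : B)
    (hloc : ∀ x, F x = v → ∃ e : OpenPartialHomeomorph E B, x ∈ e.source ∧ ⇑e = F) :
    (F ⁻¹' {v}).Finite ∧ ∃ U : Set B, IsOpen U ∧ v ∈ U ∧ ∃ s : F ⁻¹' {v} → B → E,
      (∀ x, s x v = x) ∧ (∀ x, ∀ O ⊆ U, IsOpen O → IsOpen (s x '' O)) ∧
      (∀ x, ContinuousOn (s x) U) ∧
      IsSheetFamily F U fun x u => s x u := by
  have hcomp : IsCompact (F ⁻¹' {v}) := hF.isCompact_preimage isCompact_singleton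
  have hfin : (F ⁻¹' {v}).Finite := by
    refine hcomp.finite (isDiscrete_iff_forall_mem_exists_isOpen.mpr fun x hx => ?_)
    obtain ⟨e, hxe, he⟩ := hloc x hx
    refine ⟨e.source, e.open_source, ?_⟩
    ext y
    constructor
    · rintro ⟨hy, hyv⟩
      exact e.injOn hy hxe (by rw [he]; exact hyv.trans hx.symm)
    · rintro rfl
      exact ⟨hxe, hx⟩
  have := hfin.to_subtype
  refine ⟨hfin, ?_⟩
  obtain ⟨O, hO, hdisj⟩ := hfin.t2_separation
  choose e hxe he using fun x : F ⁻¹' {v} => hloc x x.2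
  let e' : F ⁻¹' {v} → OpenPartialHomeomorph E B := fun x => (e x).restrOpen (O x) (hO x).2
  have he' : ∀ x, ⇑(e' x) = F := fun x => he x
  have hsrc : ∀ x, (e' x).source ⊆ O x := fun x y hy => by
    rw [OpenPartialHomeomorph.restrOpen_source] at hy
    exact hy.2
  have hxe' : ∀ x, x.1 ∈ (e' x).source := fun x => by
    rw [OpenPartialHomeomorph.restrOpen_source]
    exact ⟨hxe x, (hO x).1⟩
  let S : Set E := ⋃ x, (e' x).source
  have hS : IsOpen S := isOpen_iUnion fun x => (e' x).open_source
  let U : Set B := (⋂ x, (e' x).target) ∩ (F '' Sᶜ)ᶜ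
  have hUt : ∀ x, U ⊆ (e' x).target := fun x u hu => Set.mem_iInter.mp hu.1 x
  have hsv : ∀ x : F ⁻¹' {v}, (e' x).symm v = x := fun x => by
    have := (e' x).left_inv (hxe' x)
    rwa [he', x.2] at this
  refine ⟨U, ?_, ?_, fun x => (e' x).symm, hsv, ?_, ?_, ?_, ?_, ?_, ?_⟩
  · exact (isOpen_iInter_of_finite fun x => (e' x).open_target).inter
      (hF.isClosedMap _ hS.isClosed_compl).isOpen_compl
  · refine ⟨Set.mem_iInter.mpr fun x => ?_, ?_⟩
    · have := (e' x).map_source (hxe' x)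
      rwa [he', x.2] at this
    · rintro ⟨y, hy, hyv⟩
      exact hy (Set.mem_iUnion.mpr ⟨⟨y, hyv⟩, hxe' ⟨y, hyv⟩⟩)
  · intro x A hA hAo
    exact (e' x).symm.isOpen_image_of_subset_source hAo (hA.trans (hUt x))
  · exact fun x => (e' x).continuousOn_symm.mono (hUt x)
  · exact fun x => ((e' x).continuousOn_symm.mono (hUt x)).domRestrict
  · intro x u
    have := (e' x).right_inv (hUt x u.2)
    rwa [he'] at this
  · intro u x y hxy
    have hxy : (e' x).symm u.1 = (e' y).symm u.1 := hxy
    by_contra hne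
    have h1 := hsrc x ((e' x).map_target (hUt x u.2))
    have h2 := hsrc y ((e' y).map_target (hUt y u.2))
    rw [← hxy] at h2
    exact Set.disjoint_left.mp (hdisj x.2 y.2 fun h => hne (Subtype.ext h)) h1 h2
  · intro y hy
    have hyS : y ∈ S := by
      by_contra hn
      exact hy.2 ⟨y, hn, rfl⟩
    obtain ⟨x, hx⟩ := Set.mem_iUnion.mp hyS
    refine ⟨x, ?_⟩
    have := (e' x).left_inv hx
    rwa [he'] at this

/-- An open continuous map that is injective on an open set has a continuous section over the image
of that set. -/
theorem exists_continuous_section {X Y : Type*} [TopologicalSpace X] [TopologicalSpace Y]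
    {q : X → Y} (hq : Continuous q) (ho : IsOpenMap q) {U : Set X} (hU : IsOpen U)
    (hinj : Set.InjOn q U) :
    ∃ r : q '' U → X, Continuous r ∧ ∀ y, r y ∈ U ∧ q (r y) = y := by
  have hemb : IsOpenEmbedding (U.domRestrict q) :=
    .of_continuous_injective_isOpenMap (hq.comp continuous_subtype_val)
      (Set.injOn_iff_injective.mp hinj) (ho.comp hU.isOpenMap_subtype_val)
  have hr : ∀ y : q '' U, y.1 ∈ Set.range (U.domRestrict q) := fun y => by
    rw [Set.range_domRestrict]
    exact y.2
  let h := hemb.isEmbedding.toHomeomorph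
  refine ⟨fun y => (h.symm ⟨y.1, hr y⟩).1, ?_, fun y => ⟨(h.symm _).2, ?_⟩⟩
  · exact continuous_subtype_val.comp (h.symm.continuous.comp
      (Continuous.subtype_mk continuous_subtype_val _))
  · exact congrArg Subtype.val (h.apply_symm_apply ⟨y.1, hr y⟩)

/-! ### Complex polynomials in several variables -/

open MvPolynomial in
theorem finrank_restrictTotalDegree (ι : Type*) [Fintype ι] (K : ℕ) :
    Module.finrank ℂ (restrictTotalDegree ι ℂ K) =
      (K + Fintype.card ι).choose (Fintype.card ι) := by
  classical
  have hset : {n : ι →₀ ℕ | (n.sum fun _ e => e) ≤ K} =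
      ((Finset.range (K + 1)).biUnion fun j => Finset.finsuppAntidiag Finset.univ j :
        Finset (ι →₀ ℕ)) := by
    ext α
    simp [Finset.mem_finsuppAntidiag, Finsupp.sum_fintype]
  rw [restrictTotalDegree, Module.finrank_eq_nat_card_basis (basisRestrictSupport ℂ _),
    ← Nat.sum_range_multichoose, hset, Nat.card_coe_set_eq, Set.ncard_coe_finset,
    Finset.card_biUnion]
  · exact Finset.sum_congr rfl fun j _ => by
      rw [Finset.card_finsuppAntidiag_nat_eq_multichoose, Finset.card_univ]
  · intro i _ j _ hij
    rw [Function.onFun, Finset.disjoint_left]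
    intro α hi hj
    rw [Finset.mem_finsuppAntidiag] at hi hj
    exact hij (hi.1.symm.trans hj.1)

namespace MvPoly

open MvPolynomial

variable {ι : Type*}

theorem totalDegree_bind₁_le {P : ι → MvPolynomial ι ℂ} {d : ℕ}
    (hP : ∀ i, (P i).totalDegree ≤ d) (b : MvPolynomial ι ℂ) :
    (bind₁ P b).totalDegree ≤ d * b.totalDegree := by
  conv_lhs => rw [b.as_sum]
  rw [map_sum]
  refine totalDegree_finsetSum_le fun α hα => ?_
  rw [bind₁_monomial]
  refine (totalDegree_mul _ _).trans ?_
  rw [totalDegree_C, zero_add]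
  refine (totalDegree_finsetProd _ _).trans ?_
  calc ∑ i ∈ α.support, (P i ^ α i).totalDegree ≤ ∑ i ∈ α.support, d * α i :=
        Finset.sum_le_sum fun i _ => (totalDegree_pow _ _).trans
          (by rw [mul_comm]; exact Nat.mul_le_mul_right _ (hP i))
    _ = d * α.sum fun _ e => e := by rw [← Finset.mul_sum, Finsupp.sum]
    _ ≤ d * b.totalDegree := Nat.mul_le_mul_left _ (le_totalDegree hα)

variable [Fintype ι]

theorem norm_prod_pow_le (x : ι → ℂ) (α : ι →₀ ℕ) :
    ‖∏ i, x i ^ α i‖ ≤ ‖x‖ ^ α.sum fun _ e => e := by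
  rw [norm_prod, Finsupp.sum_fintype _ _ fun _ => rfl, ← Finset.prod_pow_eq_pow_sum]
  refine Finset.prod_le_prod (fun _ _ => norm_nonneg _) fun i _ => ?_
  rw [norm_pow]
  exact pow_le_pow_left₀ (norm_nonneg _) (norm_le_pi_norm x i) _

theorem norm_eval_le {a : MvPolynomial ι ℂ} {N : ℕ} (ha : a.totalDegree ≤ N) :
    ∃ C : ℝ, 0 ≤ C ∧ ∀ x, ‖eval x a‖ ≤ C * (1 + ‖x‖) ^ N := by
  refine ⟨∑ α ∈ a.support, ‖a.coeff α‖, Finset.sum_nonneg fun _ _ => norm_nonneg _, fun x => ?_⟩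
  rw [eval_eq', Finset.sum_mul]
  refine (norm_sum_le _ _).trans (Finset.sum_le_sum fun α hα => ?_)
  rw [norm_mul]
  refine mul_le_mul_of_nonneg_left ((norm_prod_pow_le x α).trans ?_) (norm_nonneg _)
  have hx := norm_nonneg x
  exact (pow_le_pow_left₀ hx (by linarith) _).trans
    (pow_le_pow_right₀ (by linarith) ((le_totalDegree hα).trans ha))

theorem norm_eval_le_of_order {a : MvPolynomial ι ℂ} {M : ℕ}
    (ha : ∀ α ∈ a.support, M ≤ α.sum fun _ e => e) :
    ∃ C : ℝ, 0 ≤ C ∧ ∀ x, ‖x‖ ≤ 1 → ‖eval x a‖ ≤ C * ‖x‖ ^ M := by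
  refine ⟨∑ α ∈ a.support, ‖a.coeff α‖, Finset.sum_nonneg fun _ _ => norm_nonneg _,
    fun x hx => ?_⟩
  rw [eval_eq', Finset.sum_mul]
  refine (norm_sum_le _ _).trans (Finset.sum_le_sum fun α hα => ?_)
  rw [norm_mul]
  exact mul_le_mul_of_nonneg_left ((norm_prod_pow_le x α).trans
    (pow_le_pow_of_le_one (norm_nonneg x) hx (ha α hα))) (norm_nonneg _)

omit [Fintype ι] in
/-- The Taylor expansion of `a` at the point `p`. -/
noncomputable def translate (p : ι → ℂ) : MvPolynomial ι ℂ →ₐ[ℂ] MvPolynomial ι ℂ :=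
  bind₁ fun i => X i + C (p i)

omit [Fintype ι] in
theorem eval_translate (p y : ι → ℂ) (a : MvPolynomial ι ℂ) :
    eval y (translate p a) = eval (y + p) a := by
  rw [translate, ← coe_aeval_eq_eval, RingHom.coe_coe, aeval_bind₁, ← coe_aeval_eq_eval,
    RingHom.coe_coe]
  congr 2
  funext i
  simp

theorem eq_zero_of_eval_eventually_zero {a : MvPolynomial ι ℂ} {v : ι → ℂ}
    (h : ∀ᶠ x in 𝓝 v, eval x a = 0) : a = 0 := by
  obtain ⟨ε, hε, hb⟩ := Metric.eventually_nhds_iff_ball.mp h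
  refine funext_set (fun i => Metric.ball (v i) ε) (fun i => ?_) fun x hx => ?_
  · exact infinite_of_mem_nhds (v i) (Metric.ball_mem_nhds _ hε)
  · rw [map_zero]
    refine hb x ?_
    rw [ball_pi _ hε]
    exact hx

/-- The differential of `x ↦ eval x a` at `x`. -/
noncomputable def differential (a : MvPolynomial ι ℂ) (x : ι → ℂ) : (ι → ℂ) →L[ℂ] ℂ :=
  ∑ j, eval x (pderiv j a) • ContinuousLinearMap.proj j

theorem differential_apply (a : MvPolynomial ι ℂ) (x h : ι → ℂ) :
    differential a x h = ∑ j, eval x (pderiv j a) * h j := by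
  simp [differential]

theorem hasStrictFDerivAt_eval (a : MvPolynomial ι ℂ) (x : ι → ℂ) :
    HasStrictFDerivAt (fun y => eval y a) (differential a x) x := by
  classical
  induction a using MvPolynomial.induction_on with
  | C c =>
    have : differential (C c) x = 0 := by ext h; simp [differential_apply]
    rw [this]
    simpa using hasStrictFDerivAt_const c x
  | add p q hp hq =>
    have : differential (p + q) x = differential p x + differential q x := by
      ext h
      simp [differential_apply, add_mul, Finset.sum_add_distrib]
    rw [this]
    simp only [map_add]
    exact hp.add hq
  | mul_X p i hp =>
    have : differential (p * X i) x = eval x p • ContinuousLinearMap.proj i +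
        x i • differential p x := by
      ext h
      simp only [differential_apply, _root_.add_apply, _root_.smul_apply,
        ContinuousLinearMap.proj_apply, smul_eq_mul, Derivation.leibniz, pderiv_X, map_add,
        map_mul, eval_X, add_mul, Finset.sum_add_distrib, Finset.mul_sum]
      congr 1
      · rw [Finset.sum_eq_single i]
        · simp
        · intro j _ hj
          simp [Pi.single_eq_of_ne hj.symm]
        · simp
      · exact Finset.sum_congr rfl fun j _ => by ring
    rw [this]
    have hi : HasStrictFDerivAt (fun y : ι → ℂ => y i)
        (ContinuousLinearMap.proj i : (ι → ℂ) →L[ℂ] ℂ) x :=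
      (ContinuousLinearMap.proj i : (ι → ℂ) →L[ℂ] ℂ).hasStrictFDerivAt
    simp only [map_mul, eval_X]
    exact hp.mul hi

omit [Fintype ι] in
theorem eval_smul_of_isHomogeneous {a : MvPolynomial ι ℂ} {d : ℕ} (ha : a.IsHomogeneous d) (t : ℂ)
    (x : ι → ℂ) : eval (t • x) a = t ^ d * eval x a := by
  rw [eval_eq, eval_eq, Finset.mul_sum]
  refine Finset.sum_congr rfl fun α hα => ?_
  have hd : ∑ i ∈ α.support, α i = d := by
    have := ha (mem_support_iff.mp hα)
    rwa [Pi.one_def, ← Finsupp.degree_eq_weight_one] at this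
  simp only [Pi.smul_apply, smul_eq_mul, mul_pow, Finset.prod_mul_distrib,
    Finset.prod_pow_eq_pow_sum, hd]
  ring

/-- Lagrange interpolation: polynomials dual to finitely many points. -/
theorem exists_dual_polynomials {S : Set (ι → ℂ)} (hS : S.Finite) :
    ∃ e : S → MvPolynomial ι ℂ, ∀ x y : S, eval x.1 (e y) = if x = y then 1 else 0 := by
  classical
  have := hS.fintype
  have h : ∀ x y : ι → ℂ, ∃ l : MvPolynomial ι ℂ, x ≠ y → eval x l = 1 ∧ eval y l = 0 := by
    intro x y
    by_cases hxy : x = y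
    · exact ⟨0, fun h => (h hxy).elim⟩
    obtain ⟨i, hi⟩ := Function.ne_iff.mp hxy
    refine ⟨C (x i - y i)⁻¹ * (X i - C (y i)), fun _ => ⟨?_, ?_⟩⟩
    · simp [inv_mul_cancel₀ (sub_ne_zero.mpr hi)]
    · simp
  choose l hl using h
  refine ⟨fun y => ∏ z ∈ Finset.univ.erase y, l y z, fun x y => ?_⟩
  rw [eval_prod]
  split_ifs with hxy
  · subst hxy
    refine Finset.prod_eq_one fun z hz => ?_
    exact (hl x z fun h => (Finset.ne_of_mem_erase hz) (Subtype.ext h.symm)).1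
  · refine Finset.prod_eq_zero (Finset.mem_erase.mpr ⟨hxy, Finset.mem_univ x⟩) ?_
    exact (hl y x fun h => hxy (Subtype.ext h.symm)).2

/-! ### Homogeneous polynomial maps without nontrivial zeros -/

/-- The polynomial map with components `P`. -/
noncomputable def polyMap (P : ι → MvPolynomial ι ℂ) (x : ι → ℂ) : ι → ℂ := fun i => eval x (P i)

omit [Fintype ι] in
theorem continuous_polyMap (P : ι → MvPolynomial ι ℂ) : Continuous (polyMap P) :=
  continuous_pi fun i => MvPolynomial.continuous_eval (P i)

omit [Fintype ι] in
theorem eval_bind₁_eq (P : ι → MvPolynomial ι ℂ) (x : ι → ℂ) (b : MvPolynomial ι ℂ) :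
    eval x (bind₁ P b) = eval (polyMap P x) b := by
  rw [← coe_aeval_eq_eval, RingHom.coe_coe, aeval_bind₁, ← coe_aeval_eq_eval, RingHom.coe_coe]
  rfl

/-- By homogeneity and compactness of the unit sphere. -/
theorem norm_pow_le_norm_polyMap {P : ι → MvPolynomial ι ℂ} {d : ℕ} (hd : d ≠ 0)
    (hP : ∀ i, (P i).IsHomogeneous d) (h0 : ∀ x, polyMap P x = 0 → x = 0) :
    ∃ c : ℝ, 0 < c ∧ ∀ x, c * ‖x‖ ^ d ≤ ‖polyMap P x‖ := by
  have hscale : ∀ (t : ℂ) x, polyMap P (t • x) = t ^ d • polyMap P x := fun t x => by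
    funext i
    simp [polyMap, eval_smul_of_isHomogeneous (hP i)]
  rcases (Metric.sphere (0 : ι → ℂ) 1).eq_empty_or_nonempty with hemp | hne
  · refine ⟨1, one_pos, fun x => ?_⟩
    have hx : x = 0 := by
      by_contra hx
      have : ((‖x‖⁻¹ : ℝ) : ℂ) • x ∈ Metric.sphere (0 : ι → ℂ) 1 := by
        simp [norm_smul, inv_mul_cancel₀ (norm_ne_zero_iff.mpr hx)]
      rw [hemp] at this
      exact this
    simp [hx, hd]
  · obtain ⟨u, hu, hmin⟩ := (isCompact_sphere (0 : ι → ℂ) 1).exists_isMinOn hne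
      (continuous_polyMap P).norm.continuousOn
    have hu1 : ‖u‖ = 1 := by simpa using hu
    refine ⟨‖polyMap P u‖, norm_pos_iff.mpr fun h => ?_, fun x => ?_⟩
    · rw [h0 u h, norm_zero] at hu1
      exact zero_ne_one hu1
    · rcases eq_or_ne x 0 with rfl | hx
      · simp [hd]
      have hxn := norm_ne_zero_iff.mpr hx
      have hmem : ((‖x‖⁻¹ : ℝ) : ℂ) • x ∈ Metric.sphere (0 : ι → ℂ) 1 := by
        simp [norm_smul, inv_mul_cancel₀ hxn]
      have h1 := hmin hmem
      simp only [Set.mem_ofPred_eq, hscale, norm_smul, norm_pow, Complex.norm_real, norm_inv,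
        norm_norm] at h1
      calc ‖polyMap P u‖ * ‖x‖ ^ d ≤ (‖x‖⁻¹ ^ d * ‖polyMap P x‖) * ‖x‖ ^ d :=
            mul_le_mul_of_nonneg_right h1 (by positivity)
        _ = ‖polyMap P x‖ := by
            rw [mul_right_comm, ← mul_pow, inv_mul_cancel₀ hxn, one_pow, one_mul]

theorem isProperMap_polyMap {P : ι → MvPolynomial ι ℂ} {d : ℕ} (hd : d ≠ 0)
    (hP : ∀ i, (P i).IsHomogeneous d) (h0 : ∀ x, polyMap P x = 0 → x = 0) :
    IsProperMap (polyMap P) := by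
  obtain ⟨c, hc, hle⟩ := norm_pow_le_norm_polyMap hd hP h0
  rw [isProperMap_iff_tendsto_cocompact]
  refine ⟨continuous_polyMap P, ?_⟩
  rw [← Metric.cobounded_eq_cocompact, ← comap_norm_atTop, tendsto_comap_iff]
  refine tendsto_atTop_mono hle ?_
  exact ((tendsto_pow_atTop hd).const_mul_atTop hc).comp tendsto_comap

/-- The Jacobian of `P` at `x` has trivial kernel. -/
def Nondegenerate (P : ι → MvPolynomial ι ℂ) (x : ι → ℂ) : Prop :=
  ∀ h : ι → ℂ, (∀ i, ∑ j, eval x (pderiv j (P i)) * h j = 0) → h = 0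

theorem exists_hasStrictFDerivAt_equiv {P : ι → MvPolynomial ι ℂ} {x : ι → ℂ}
    (hx : Nondegenerate P x) :
    ∃ L : (ι → ℂ) ≃L[ℂ] (ι → ℂ), HasStrictFDerivAt (polyMap P) (L : (ι → ℂ) →L[ℂ] (ι → ℂ)) x := by
  let A : (ι → ℂ) →L[ℂ] (ι → ℂ) := ContinuousLinearMap.pi fun i => differential (P i) x
  have hA : Function.Injective A.toLinearMap := by
    rw [← LinearMap.ker_eq_bot, LinearMap.ker_eq_bot']
    intro h hh
    refine hx h fun i => ?_
    rw [← differential_apply]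
    exact congrFun hh i
  let L := (LinearEquiv.ofInjectiveEndo A.toLinearMap hA).toContinuousLinearEquiv
  refine ⟨L, ?_⟩
  have hL : (L : (ι → ℂ) →L[ℂ] (ι → ℂ)) = A := by
    ext1 h
    rfl
  rw [hL]
  exact hasStrictFDerivAt_pi.mpr fun i => hasStrictFDerivAt_eval (P i) x

end MvPoly

/-! ### Bounded holomorphic functions off a finite set -/

theorem exists_entire_extension {T : Set ℂ} (hT : T.Finite) :
    ∀ q : ℂ → ℂ, DifferentiableOn ℂ q Tᶜ → (∃ C, ∀ z ∉ T, ‖q z‖ ≤ C) →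
      ∃ Q : ℂ → ℂ, Differentiable ℂ Q ∧ ∀ z ∉ T, Q z = q z := by
  induction T, hT using Set.Finite.induction_on with
  | empty =>
    intro q hq _
    exact ⟨q, by rwa [Set.compl_empty, differentiableOn_univ] at hq, fun _ _ => rfl⟩
  | @insert c T hc hT ih =>
    rintro q hq ⟨C, hC⟩
    have hset : Tᶜ \ {c} = (insert c T)ᶜ := by
      ext z
      simp only [Set.mem_sdiff, Set.mem_compl_iff, Set.mem_singleton_iff, Set.mem_insert_iff]
      tauto
    have hd := Complex.differentiableOn_update_limUnder_of_bddAbove (f := q)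
      (hT.isClosed.isOpen_compl.mem_nhds hc) (hset ▸ hq) (by
        rw [hset]
        refine ⟨C, ?_⟩
        rintro _ ⟨z, hz, rfl⟩
        exact hC z hz)
    obtain ⟨Q, hQ, hQq⟩ := ih _ hd (by
      refine ⟨max C ‖limUnder (𝓝[≠] c) q‖, fun z hz => ?_⟩
      by_cases hzc : z = c
      · subst hzc
        rw [Function.update_self]
        exact le_max_right _ _
      · rw [Function.update_of_ne hzc]
        exact (hC z fun h => h.elim hzc hz).trans (le_max_left _ _))
    refine ⟨Q, hQ, fun z hz => ?_⟩
    rw [Set.mem_insert_iff, not_or] at hz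
    rw [hQq z hz.2, Function.update_of_ne hz.1]

/-- Riemann's and Liouville's theorems combined. -/
theorem eq_zero_of_bounded_of_tendsto {T : Set ℂ} (hT : T.Finite) {q : ℂ → ℂ}
    (hq : DifferentiableOn ℂ q Tᶜ) (hb : ∃ C, ∀ z ∉ T, ‖q z‖ ≤ C)
    (h0 : Tendsto q (cocompact ℂ) (𝓝 0)) : ∀ z ∉ T, q z = 0 := by
  obtain ⟨Q, hQ, hQq⟩ := exists_entire_extension hT q hq hb
  have hlim : Tendsto Q (cocompact ℂ) (𝓝 0) := by
    refine h0.congr' ?_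
    filter_upwards [hT.isCompact.compl_mem_cocompact] with z hz
    exact (hQq z hz).symm
  intro z hz
  rw [← hQq z hz]
  exact hQ.apply_eq_of_tendsto_cocompact z hlim

/-! ### The number of points in a fibre of a homogeneous polynomial map -/

theorem pow_le_of_choose_le {m d k : ℕ}
    (h : ∀ K : ℕ, (d * K + m).choose m ≤ k * (K + m).choose m) : d ^ m ≤ k := by
  have hK : ∀ K : ℕ, (d * K) ^ m ≤ k * (K + m) ^ m := fun K => calc
    (d * K) ^ m ≤ (d * K + 1) ^ m := Nat.pow_le_pow_left (Nat.le_succ _) _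
    _ ≤ (d * K + 1).ascFactorial m := Nat.pow_succ_le_ascFactorial _ _
    _ = m.factorial * (d * K + m).choose m := Nat.ascFactorial_eq_factorial_mul_choose _ _
    _ ≤ m.factorial * (k * (K + m).choose m) := Nat.mul_le_mul_left _ (h K)
    _ = k * (K + 1).ascFactorial m := by
      rw [Nat.ascFactorial_eq_factorial_mul_choose]; ring
    _ ≤ k * (K + m) ^ m := Nat.mul_le_mul_left _ (Nat.ascFactorial_le_pow_add _ _)
  have hlim : Tendsto (fun K : ℕ => (k : ℝ) * (1 + (m : ℝ) / K) ^ m) atTop (𝓝 (k * (1 + 0) ^ m)) :=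
    ((tendsto_const_nhds.add (tendsto_const_div_atTop_nhds_zero_nat _)).pow m).const_mul _
  have hle : ((d ^ m : ℕ) : ℝ) ≤ k * (1 + 0) ^ m := by
    refine ge_of_tendsto hlim ?_
    filter_upwards [eventually_gt_atTop 0] with K hK0
    have hK0' : (0 : ℝ) < K := by exact_mod_cast hK0
    have h1 : ((d : ℝ) * K) ^ m ≤ k * (K + m) ^ m := by exact_mod_cast hK K
    have h2 : (1 + (m : ℝ) / K) = (K + m) / K := by field_simp
    rw [h2, div_pow, Nat.cast_pow, ← mul_div_assoc, le_div_iff₀ (by positivity), ← mul_pow]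
    exact h1
  rw [add_zero, one_pow, mul_one] at hle
  exact_mod_cast hle

theorem le_pow_of_choose_le {m d k D : ℕ}
    (h : ∀ K : ℕ, k * (K + m).choose m ≤ (d * K + D + m).choose m) : k ≤ d ^ m := by
  have hK : ∀ K : ℕ, k * K ^ m ≤ (d * K + D + m) ^ m := fun K => calc
    k * K ^ m ≤ k * (K + 1) ^ m :=
      Nat.mul_le_mul_left _ (Nat.pow_le_pow_left (Nat.le_succ _) _)
    _ ≤ k * (K + 1).ascFactorial m := Nat.mul_le_mul_left _ (Nat.pow_succ_le_ascFactorial _ _)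
    _ = m.factorial * (k * (K + m).choose m) := by
      rw [Nat.ascFactorial_eq_factorial_mul_choose]; ring
    _ ≤ m.factorial * (d * K + D + m).choose m := Nat.mul_le_mul_left _ (h K)
    _ = (d * K + D + 1).ascFactorial m := (Nat.ascFactorial_eq_factorial_mul_choose _ _).symm
    _ ≤ (d * K + D + m) ^ m := Nat.ascFactorial_le_pow_add _ _
  have hlim : Tendsto (fun K : ℕ => ((d : ℝ) + ((D + m : ℕ) : ℝ) / K) ^ m) atTop
      (𝓝 ((d + 0) ^ m)) :=
    (tendsto_const_nhds.add (tendsto_const_div_atTop_nhds_zero_nat _)).pow m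
  have hle : (k : ℝ) ≤ (d + 0) ^ m := by
    refine ge_of_tendsto hlim ?_
    filter_upwards [eventually_gt_atTop 0] with K hK0
    have hK0' : (0 : ℝ) < K := by exact_mod_cast hK0
    have h1 : (k : ℝ) * K ^ m ≤ (d * K + D + m) ^ m := by exact_mod_cast hK K
    have h2 : (d : ℝ) + ((D + m : ℕ) : ℝ) / K = (d * K + D + m) / K := by
      push_cast; field_simp; ring
    rw [h2, div_pow, le_div_iff₀ (by positivity)]
    exact h1
  rw [add_zero] at hle
  exact_mod_cast hle

/-- The product of the values of `f` over the fibre of `F` at `u`. -/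
noncomputable def fiberNorm {E B : Type*} (F : E → B) (f : E → ℂ) (u : B) : ℂ :=
  ∏ᶠ x : F ⁻¹' {u}, f x

theorem IsSheetFamily.fiberNorm_eq {E B ι : Type*} [TopologicalSpace E] [TopologicalSpace B]
    [Fintype ι] {F : E → B} {U : Set B} {s : ι → U → E} (h : IsSheetFamily F U s) (f : E → ℂ)
    {u : B} (hu : u ∈ U) : fiberNorm F f u = ∏ i, f (s i ⟨u, hu⟩) := by
  rw [fiberNorm, ← finprod_eq_prod_of_fintype]
  exact (finprod_comp (g := fun x : F ⁻¹' {u} => f x) _ (h.bijective hu)).symm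

namespace MvPoly

open MvPolynomial

variable {ι : Type*} [Fintype ι] {P : ι → MvPolynomial ι ℂ} {d : ℕ}

/-- The inverse function theorem and properness of `polyMap P` give the local structure of
`polyMap P` over a regular value. -/
theorem exists_branches (hd : d ≠ 0) (hP : ∀ i, (P i).IsHomogeneous d)
    (h0 : ∀ x, polyMap P x = 0 → x = 0) {v : ι → ℂ}
    (hv : ∀ x, polyMap P x = v → Nondegenerate P x) :
    (polyMap P ⁻¹' {v}).Finite ∧ ∃ U : Set (ι → ℂ), IsOpen U ∧ v ∈ U ∧
      ∃ s : polyMap P ⁻¹' {v} → (ι → ℂ) → ι → ℂ,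
      (∀ x, s x v = x) ∧ (∀ x, ∀ O ⊆ U, IsOpen O → IsOpen (s x '' O)) ∧
      (∀ x, ContinuousOn (s x) U) ∧ (∀ x, DifferentiableAt ℂ (s x) v) ∧
      IsSheetFamily (polyMap P) U fun x u => s x u := by
  obtain ⟨hfin, U, hU, hvU, s, hs, hsO, hsc, hsf⟩ :=
    exists_inverse_branches (isProperMap_polyMap hd hP h0) v (fun x hx => by
      obtain ⟨L, hL⟩ := exists_hasStrictFDerivAt_equiv (hv x hx)
      exact ⟨hL.toOpenPartialHomeomorph _, hL.mem_toOpenPartialHomeomorph_source,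
        hL.toOpenPartialHomeomorph_coe⟩)
  refine ⟨hfin, U, hU, hvU, s, hs, hsO, hsc, fun x => ?_, hsf⟩
  obtain ⟨L, hL⟩ := exists_hasStrictFDerivAt_equiv (hv x x.2)
  refine (HasFDerivAt.of_local_left_inverse (f := polyMap P) (f' := L)
    ((hsc x).continuousAt (hU.mem_nhds hvU)) ?_ ?_).differentiableAt
  · rw [hs]
    exact hL.hasFDerivAt
  · filter_upwards [hU.mem_nhds hvU] with u hu
    exact hsf.apply x ⟨u, hu⟩

/-- Upper bound for the number `k` of points over a regular value: if `e y` are polynomials dual to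
the points of the fibre, then the products of the `e y` with the monomials in `P` are linearly
independent. -/
theorem card_mul_choose_le (hd : d ≠ 0) (hP : ∀ i, (P i).IsHomogeneous d)
    (h0 : ∀ x, polyMap P x = 0 → x = 0) {v : ι → ℂ}
    (hv : ∀ x, polyMap P x = v → Nondegenerate P x) :
    ∃ D, ∀ K, Nat.card (polyMap P ⁻¹' {v}) * (K + Fintype.card ι).choose (Fintype.card ι) ≤
      (d * K + D + Fintype.card ι).choose (Fintype.card ι) := by
  classical
  obtain ⟨hfin, U, hU, hvU, s, hs, -, hsc, -, hsf⟩ := exists_branches hd hP h0 hv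
  have := hfin.fintype
  obtain ⟨e, he⟩ := exists_dual_polynomials hfin
  refine ⟨Finset.univ.sup fun y => (e y).totalDegree, fun K => ?_⟩
  set D := Finset.univ.sup fun y => (e y).totalDegree with hD
  let T₀ : (polyMap P ⁻¹' {v} → restrictTotalDegree ι ℂ K) →ₗ[ℂ] MvPolynomial ι ℂ :=
    { toFun b := ∑ y, bind₁ P (b y).1 * e y
      map_add' b c := by simp [add_mul, Finset.sum_add_distrib]
      map_smul' c b := by simp [Finset.smul_sum] }
  let T := T₀.codRestrict (restrictTotalDegree ι ℂ (d * K + D)) (fun b => by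
    rw [mem_restrictTotalDegree]
    refine totalDegree_finsetSum_le fun y _ => (totalDegree_mul _ _).trans (Nat.add_le_add ?_ ?_)
    · exact (totalDegree_bind₁_le (fun i => (hP i).totalDegree_le) _).trans
        (Nat.mul_le_mul_left _ ((mem_restrictTotalDegree _ _ _).mp (b y).2))
    · exact Finset.le_sup (f := fun y => (e y).totalDegree) (Finset.mem_univ y))
  have hinj : Function.Injective T := by
    rw [← LinearMap.ker_eq_bot, LinearMap.ker_eq_bot']
    intro b hb
    have hb : ∑ y, bind₁ P (b y).1 * e y = 0 := congrArg Subtype.val hb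
    let M : (ι → ℂ) → Matrix (polyMap P ⁻¹' {v}) (polyMap P ⁻¹' {v}) ℂ :=
      fun u => .of fun x y => eval (s x u) (e y)
    have hM : ContinuousAt (fun u => (M u).det) v := by
      refine (continuous_id.matrix_det).continuousAt.comp (f := M) ?_
      refine continuousAt_pi.mpr fun x => continuousAt_pi.mpr fun y => ?_
      exact (MvPolynomial.continuous_eval (e y)).continuousAt.comp
        ((hsc x).continuousAt (hU.mem_nhds hvU))
    have hMv : M v = 1 := by
      ext x y
      simp only [M, Matrix.of_apply, hs, he, Matrix.one_apply]
    have hdet : ∀ᶠ u in 𝓝 v, (M u).det ≠ 0 :=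
      hM.eventually_ne (by rw [hMv, Matrix.det_one]; exact one_ne_zero)
    funext y
    refine Subtype.ext (eq_zero_of_eval_eventually_zero (v := v) ?_)
    filter_upwards [hdet, hU.mem_nhds hvU] with u hu huU
    refine congrFun (Matrix.eq_zero_of_mulVec_eq_zero hu (v := fun y => eval u (b y).1) ?_) y
    funext x
    have hx := congrArg (eval (s x u)) hb
    rw [map_sum, map_zero] at hx
    simp only [map_mul, eval_bind₁_eq, hsf.apply x ⟨u, huU⟩] at hx
    simp only [Matrix.mulVec, dotProduct, M, Matrix.of_apply, Pi.zero_apply]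
    rw [← hx]
    exact Finset.sum_congr rfl fun y _ => mul_comm _ _
  have hle := LinearMap.finrank_le_finrank_of_injective hinj
  rw [Module.finrank_pi_fintype, finrank_restrictTotalDegree] at hle
  simpa [finrank_restrictTotalDegree] using hle

theorem differentiableAt_fiberNorm (hd : d ≠ 0) (hP : ∀ i, (P i).IsHomogeneous d)
    (h0 : ∀ x, polyMap P x = 0 → x = 0) {v : ι → ℂ}
    (hv : ∀ x, polyMap P x = v → Nondegenerate P x) (a : MvPolynomial ι ℂ) :
    DifferentiableAt ℂ (fiberNorm (polyMap P) fun x => eval x a) v := by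
  obtain ⟨hfin, U, hU, hvU, s, hs, -, hsc, hsd, hsf⟩ := exists_branches hd hP h0 hv
  have := hfin.fintype
  have heq : (fiberNorm (polyMap P) fun x => eval x a) =ᶠ[𝓝 v] fun u => ∏ x, eval (s x u) a := by
    filter_upwards [hU.mem_nhds hvU] with u hu
    exact hsf.fiberNorm_eq _ hu
  refine DifferentiableAt.congr_of_eventuallyEq ?_ heq
  classical
  exact (HasFDerivAt.finsetProd (𝕜 := ℂ) (u := Finset.univ) (g := fun x u => eval (s x u) a)
    fun x _ => (DifferentiableAt.comp (g := fun y => eval y a) v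
      (hasStrictFDerivAt_eval a _).hasFDerivAt.differentiableAt
      (hsd x)).hasFDerivAt).differentiableAt

/-- If `a` vanishes to order `M` at each of the `k` points over `v`, the product of its values over
the fibres vanishes to order `M * k` at `v`. -/
theorem fiberNorm_isBigO (hd : d ≠ 0) (hP : ∀ i, (P i).IsHomogeneous d)
    (h0 : ∀ x, polyMap P x = 0 → x = 0) {v : ι → ℂ}
    (hv : ∀ x, polyMap P x = v → Nondegenerate P x) {a : MvPolynomial ι ℂ} {M : ℕ}
    (ha : ∀ x, polyMap P x = v → ∀ α ∈ (translate x a).support, M ≤ α.sum fun _ e => e) :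
    (fiberNorm (polyMap P) fun x => eval x a) =O[𝓝 v]
      fun u => ‖u - v‖ ^ (M * Nat.card (polyMap P ⁻¹' {v})) := by
  obtain ⟨hfin, U, hU, hvU, s, hs, -, hsc, hsd, hsf⟩ := exists_branches hd hP h0 hv
  have := hfin.fintype
  have heq : (fiberNorm (polyMap P) fun x => eval x a) =ᶠ[𝓝 v] fun u => ∏ x, eval (s x u) a := by
    filter_upwards [hU.mem_nhds hvU] with u hu
    exact hsf.fiberNorm_eq _ hu
  refine Asymptotics.IsBigO.congr' (f₁ := fun u => ∏ x, eval (s x u) a)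
    (g₁ := fun u => ∏ _x : polyMap P ⁻¹' {v}, ‖u - v‖ ^ M) ?_ heq.symm
    (Eventually.of_forall fun u => by simp [Finset.prod_const, pow_mul])
  refine Asymptotics.IsBigO.finsetProd fun x _ => ?_
  obtain ⟨C, hC, hCle⟩ := norm_eval_le_of_order (ha x x.2)
  have h1 : (fun u => s x u - x) =O[𝓝 v] fun u => u - v := by
    have := (hsd x).isBigO_sub
    simpa only [hs] using this
  have h2 : ∀ᶠ u in 𝓝 v, ‖s x u - x‖ ≤ 1 := by
    have : Tendsto (fun u => ‖s x u - x‖) (𝓝 v) (𝓝 ‖s x v - x‖) :=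
      ((hsd x).continuousAt.sub continuousAt_const).norm
    rw [hs, sub_self, norm_zero] at this
    exact (this.eventually_lt_const one_pos).mono fun _ h => h.le
  refine Asymptotics.IsBigO.trans (g := fun u => ‖s x u - x‖ ^ M) ?_ (h1.norm_norm.pow M)
  refine Asymptotics.IsBigO.of_bound C ?_
  filter_upwards [h2] with u hu
  have := hCle _ hu
  rw [eval_translate, sub_add_cancel] at this
  simpa using this

theorem norm_fiberNorm_le (hd : d ≠ 0) (hP : ∀ i, (P i).IsHomogeneous d)
    (h0 : ∀ x, polyMap P x = 0 → x = 0) {a : MvPolynomial ι ℂ} {K : ℕ}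
    (ha : a.totalDegree ≤ d * K) :
    ∃ C : ℝ, 0 ≤ C ∧ ∀ u, (polyMap P ⁻¹' {u}).Finite →
      ‖fiberNorm (polyMap P) (fun x => eval x a) u‖ ≤
        (C * (1 + ‖u‖) ^ K) ^ Nat.card (polyMap P ⁻¹' {u}) := by
  obtain ⟨c, hc, hcle⟩ := norm_pow_le_norm_polyMap hd hP h0
  obtain ⟨C, hC, hCle⟩ := norm_eval_le ha
  let A : ℝ := 2 ^ (d - 1) * (1 + c⁻¹)
  have hA : 0 ≤ A := by positivity
  refine ⟨C * A ^ K, by positivity, fun u hfin => ?_⟩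
  have := hfin.fintype
  rw [fiberNorm, finprod_eq_prod_of_fintype, norm_prod, Nat.card_eq_fintype_card, ← Finset.card_univ,
    ← Finset.prod_const]
  refine Finset.prod_le_prod (fun _ _ => norm_nonneg _) fun x _ => ?_
  have hx : polyMap P x = u := x.2
  have h1 : (1 + ‖x.1‖) ^ d ≤ A * (1 + ‖u‖) := by
    have h2 : ‖x.1‖ ^ d ≤ c⁻¹ * ‖u‖ := by
      rw [le_inv_mul_iff₀ hc]
      exact (hcle x).trans_eq (congrArg norm hx)
    have hu := norm_nonneg u
    have hc' : 0 < c⁻¹ := inv_pos.mpr hc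
    calc (1 + ‖x.1‖) ^ d ≤ 2 ^ (d - 1) * (1 ^ d + ‖x.1‖ ^ d) :=
          add_pow_le zero_le_one (norm_nonneg _) d
      _ ≤ 2 ^ (d - 1) * ((1 + c⁻¹) * (1 + ‖u‖)) := by
          refine mul_le_mul_of_nonneg_left ?_ (by positivity)
          rw [one_pow]
          nlinarith
      _ = A * (1 + ‖u‖) := by ring
  calc ‖eval x.1 a‖ ≤ C * (1 + ‖x.1‖) ^ (d * K) := hCle x
    _ ≤ C * (A * (1 + ‖u‖)) ^ K := by
      rw [pow_mul]
      exact mul_le_mul_of_nonneg_left (pow_le_pow_left₀ (by positivity) h1 _) hC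
    _ = C * A ^ K * (1 + ‖u‖) ^ K := by rw [mul_pow, mul_assoc]

/-- An open set of regular values of `P` that meets the complex line through any two of its points
in the complement of a finite set. -/
structure IsRegularBase (P : ι → MvPolynomial ι ℂ) (W : Set (ι → ℂ)) : Prop where
  isOpen : IsOpen W
  finite_line : ∀ v ∈ W, ∀ v' ∈ W, {s : ℂ | v + s • (v' - v) ∉ W}.Finite
  nondegenerate : ∀ x, polyMap P x ∈ W → Nondegenerate P x

variable {W : Set (ι → ℂ)}

theorem IsRegularBase.nondegenerate_of_eq (hW : IsRegularBase P W) {v : ι → ℂ} (hv : v ∈ W) :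
    ∀ x, polyMap P x = v → Nondegenerate P x :=
  fun x hx => hW.nondegenerate x (by rwa [hx])

/-- The complement of a finite set in a complex line is connected, and the number of points in the
fibre is locally constant on it. -/
theorem card_fiber_eq (hd : d ≠ 0) (hP : ∀ i, (P i).IsHomogeneous d)
    (h0 : ∀ x, polyMap P x = 0 → x = 0) (hW : IsRegularBase P W) {v v' : ι → ℂ} (hv : v ∈ W)
    (hv' : v' ∈ W) : Nat.card (polyMap P ⁻¹' {v}) = Nat.card (polyMap P ⁻¹' {v'}) := by
  let γ : ℂ → ι → ℂ := fun s => v + s • (v' - v)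
  have hγ : Continuous γ := by fun_prop
  have hconn : IsPreconnected {s : ℂ | γ s ∉ W}ᶜ :=
    ((hW.finite_line v hv v' hv').countable.isConnected_compl_of_one_lt_rank
      (by rw [Complex.rank_real_complex]; exact Nat.one_lt_ofNat)).isPreconnected
  have hcont : ContinuousOn (fun s => Nat.card (polyMap P ⁻¹' {γ s})) {s : ℂ | γ s ∉ W}ᶜ := by
    intro s hs
    have hs : γ s ∈ W := not_not.mp hs
    obtain ⟨-, U, hU, hsU, σ, -, -, -, -, hσ⟩ :=
      exists_branches hd hP h0 (hW.nondegenerate_of_eq hs)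
    refine (ContinuousAt.congr (f := fun _ => Nat.card (polyMap P ⁻¹' {γ s})) continuousAt_const
      ?_).continuousWithinAt
    filter_upwards [hγ.continuousAt.preimage_mem_nhds (hU.mem_nhds hsU)] with t ht
    exact (hσ.card_fiber ht).symm
  have h0' : γ 0 = v := by simp [γ]
  have h1' : γ 1 = v' := by simp [γ]
  have := hconn.constant hcont (x := 0) (y := 1)
    (by simp only [Set.mem_compl_iff, Set.mem_ofPred_eq, not_not]; rwa [h0'])
    (by simp only [Set.mem_compl_iff, Set.mem_ofPred_eq, not_not]; rwa [h1'])
  simpa only [h0', h1'] using this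

/-- On the line through `v` and `v'`, the quotient of the norm of `a` by a power of the parameter is
bounded near `0`, since `a` vanishes to order `K + 1` over `v`, and tends to `0` at infinity, since
the degree of `a` is at most `d * K`. -/
theorem fiberNorm_eq_zero (hd : d ≠ 0) (hP : ∀ i, (P i).IsHomogeneous d)
    (h0 : ∀ x, polyMap P x = 0 → x = 0) (hW : IsRegularBase P W) {v v' : ι → ℂ} (hv : v ∈ W)
    (hv' : v' ∈ W) (hk : Nat.card (polyMap P ⁻¹' {v}) ≠ 0) {a : MvPolynomial ι ℂ} {K : ℕ}
    (hdeg : a.totalDegree ≤ d * K)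
    (ha : ∀ x, polyMap P x = v → ∀ α ∈ (translate x a).support, K + 1 ≤ α.sum fun _ e => e) :
    fiberNorm (polyMap P) (fun x => eval x a) v' = 0 := by
  set k := Nat.card (polyMap P ⁻¹' {v}) with hkdef
  let N : (ι → ℂ) → ℂ := fiberNorm (polyMap P) fun x => eval x a
  change N v' = 0
  let w := v' - v
  let γ : ℂ → ι → ℂ := fun s => v + s • w
  have hγ : Differentiable ℂ γ := by fun_prop
  have hγ0 : γ 0 = v := by simp [γ]
  have hγ1 : γ 1 = v' := by simp [γ, w]
  let T : Set ℂ := insert 0 {s | γ s ∉ W}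
  have hT : T.Finite := (hW.finite_line v hv v' hv').insert 0
  have hTW : ∀ s ∉ T, γ s ∈ W ∧ s ≠ 0 := fun s hs =>
    ⟨by_contra fun h => hs (Or.inr h), fun h => hs (Or.inl h)⟩
  let q : ℂ → ℂ := fun s => N (γ s) / s ^ ((K + 1) * k)
  have hq : DifferentiableOn ℂ q Tᶜ := by
    intro s hs
    obtain ⟨hsW, hs0⟩ := hTW s hs
    have h1 : DifferentiableAt ℂ (fun s => N (γ s)) s :=
      DifferentiableAt.comp s
        (differentiableAt_fiberNorm hd hP h0 (hW.nondegenerate_of_eq hsW) a) (hγ s)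
    exact (h1.div (differentiableAt_id.pow _) (pow_ne_zero _ hs0)).differentiableWithinAt
  obtain ⟨C₀, hC₀, hnear⟩ : ∃ C₀, 0 ≤ C₀ ∧ ∀ᶠ s in 𝓝 (0 : ℂ), s ≠ 0 → ‖q s‖ ≤ C₀ := by
    have hO := fiberNorm_isBigO hd hP h0 (hW.nondegenerate_of_eq hv) ha
    obtain ⟨C, hCpos, hC⟩ := hO.exists_pos
    refine ⟨C * ‖w‖ ^ ((K + 1) * k), by positivity, ?_⟩
    have ht : Tendsto γ (𝓝 0) (𝓝 v) := by
      have := hγ.continuous.tendsto 0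
      rwa [hγ0] at this
    filter_upwards [ht.eventually hC.bound] with s hs hs0
    have hs' : ‖N (γ s)‖ ≤ C * (‖s‖ * ‖w‖) ^ ((K + 1) * k) := by
      simpa [γ, N, norm_smul, ← hkdef] using hs
    have hspos : 0 < ‖s‖ ^ ((K + 1) * k) := pow_pos (norm_pos_iff.mpr hs0) _
    rw [norm_div, norm_pow, div_le_iff₀ hspos]
    refine hs'.trans_eq ?_
    rw [mul_pow]
    ring
  obtain ⟨ε, hε, hball⟩ := Metric.eventually_nhds_iff_ball.mp hnear
  obtain ⟨C, hC, hNle⟩ := norm_fiberNorm_le hd hP h0 hdeg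
  let B : ℝ := (1 + ‖v‖) / ε + ‖w‖
  have hfar : ∀ s ∉ T, ε ≤ ‖s‖ → ‖q s‖ ≤ (C * B ^ K) ^ k / ‖s‖ ^ k := by
    intro s hs hεs
    obtain ⟨hsW, hs0⟩ := hTW s hs
    have hspos : 0 < ‖s‖ := norm_pos_iff.mpr hs0
    have hcard : Nat.card (polyMap P ⁻¹' {γ s}) = k := (card_fiber_eq hd hP h0 hW hv hsW).symm
    have hfin : (polyMap P ⁻¹' {γ s}).Finite := (exists_branches hd hP h0
      (hW.nondegenerate_of_eq hsW)).1
    have h1 := hNle (γ s) hfin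
    rw [hcard] at h1
    have h2 : 1 + ‖γ s‖ ≤ B * ‖s‖ := by
      have h3 : ‖γ s‖ ≤ ‖v‖ + ‖s‖ * ‖w‖ := (norm_add_le _ _).trans_eq (by rw [norm_smul])
      have h4 : 1 + ‖v‖ ≤ (1 + ‖v‖) / ε * ‖s‖ := by
        rw [div_mul_eq_mul_div, le_div_iff₀ hε]
        exact mul_le_mul_of_nonneg_left hεs (by positivity)
      calc 1 + ‖γ s‖ ≤ (1 + ‖v‖) + ‖s‖ * ‖w‖ := by linarith
        _ ≤ (1 + ‖v‖) / ε * ‖s‖ + ‖s‖ * ‖w‖ := by linarith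
        _ = B * ‖s‖ := by ring
    have h5 : (C * (1 + ‖γ s‖) ^ K) ^ k ≤ (C * (B * ‖s‖) ^ K) ^ k :=
      pow_le_pow_left₀ (by positivity)
        (mul_le_mul_of_nonneg_left (pow_le_pow_left₀ (by positivity) h2 _) hC) _
    rw [norm_div, norm_pow, div_le_div_iff₀ (by positivity) (by positivity)]
    calc ‖N (γ s)‖ * ‖s‖ ^ k ≤ (C * (B * ‖s‖) ^ K) ^ k * ‖s‖ ^ k :=
          mul_le_mul_of_nonneg_right (h1.trans h5) (by positivity)
      _ = (C * B ^ K) ^ k * ‖s‖ ^ ((K + 1) * k) := by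
          rw [mul_pow, mul_pow, mul_pow, add_mul, one_mul, pow_add, pow_mul ‖s‖ K k]
          ring
  have hB : 0 ≤ B := by positivity
  have hbound : ∃ C, ∀ s ∉ T, ‖q s‖ ≤ C := by
    refine ⟨max C₀ ((C * B ^ K) ^ k / ε ^ k), fun s hs => ?_⟩
    rcases lt_or_ge ‖s‖ ε with h | h
    · exact (hball s (by simpa using h) (hTW s hs).2).trans (le_max_left _ _)
    · refine (hfar s hs h).trans (le_trans ?_ (le_max_right _ _))
      exact div_le_div_of_nonneg_left (by positivity) (by positivity)
        (pow_le_pow_left₀ hε.le h _)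
  have hlim : Tendsto q (cocompact ℂ) (𝓝 0) := by
    have h1 : Tendsto (fun s : ℂ => (C * B ^ K) ^ k / ‖s‖ ^ k) (cocompact ℂ) (𝓝 0) :=
      ((tendsto_pow_atTop hk).comp tendsto_norm_cocompact_atTop).const_div_atTop _
    refine squeeze_zero_norm' ?_ h1
    filter_upwards [hT.isCompact.compl_mem_cocompact,
      tendsto_norm_cocompact_atTop.eventually_ge_atTop ε] with s hs hεs
    exact hfar s hs hεs
  have h1T : (1 : ℂ) ∉ T := by
    rintro (h | h)
    · exact one_ne_zero h
    · exact h (by rwa [hγ1])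
  have := eq_zero_of_bounded_of_tendsto hT hq hbound hlim 1 h1T
  simpa [q, hγ1] using this

/-- A nonzero polynomial has no zeros on a suitable fibre, because the branches of the inverse are
open. -/
theorem exists_fiberNorm_ne_zero (hd : d ≠ 0) (hP : ∀ i, (P i).IsHomogeneous d)
    (h0 : ∀ x, polyMap P x = 0 → x = 0) (hW : IsRegularBase P W) {v : ι → ℂ} (hv : v ∈ W)
    {a : MvPolynomial ι ℂ} (ha : a ≠ 0) :
    ∃ v' ∈ W, fiberNorm (polyMap P) (fun x => eval x a) v' ≠ 0 := by
  classical
  obtain ⟨hfin, U, hU, hvU, s, -, hsO, hsc, -, hsf⟩ :=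
    exists_branches hd hP h0 (hW.nondegenerate_of_eq hv)
  have := hfin.fintype
  have key : ∀ S : Finset (polyMap P ⁻¹' {v}), ∃ O ⊆ W ∩ U, IsOpen O ∧ O.Nonempty ∧
      ∀ x ∈ S, ∀ u ∈ O, eval (s x u) a ≠ 0 := by
    intro S
    induction S using Finset.induction_on with
    | empty => exact ⟨W ∩ U, subset_rfl, hW.isOpen.inter hU, ⟨v, hv, hvU⟩, by simp⟩
    | insert x S _ ih =>
      obtain ⟨O, hOW, hO, ⟨u, hu⟩, hOS⟩ := ih
      have hopen := hsO x O (hOW.trans Set.inter_subset_right) hO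
      obtain ⟨y, ⟨u', hu', rfl⟩, hy⟩ : ∃ y ∈ s x '' O, eval y a ≠ 0 := by
        by_contra! hcon
        refine ha (eq_zero_of_eval_eventually_zero (v := s x u) ?_)
        filter_upwards [hopen.mem_nhds ⟨u, hu, rfl⟩] with y hy
        exact hcon y hy
      have hc : ContinuousOn (fun u => eval (s x u) a) O :=
        (MvPolynomial.continuous_eval a).comp_continuousOn
          ((hsc x).mono (hOW.trans Set.inter_subset_right))
      refine ⟨O ∩ (fun u => eval (s x u) a) ⁻¹' {0}ᶜ, Set.inter_subset_left.trans hOW,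
        hc.isOpen_inter_preimage hO isClosed_singleton.isOpen_compl, ⟨u', hu', hy⟩, ?_⟩
      intro z hz t ht
      rcases Finset.mem_insert.mp hz with rfl | hz
      · exact ht.2
      · exact hOS z hz t ht.1
  obtain ⟨O, hOW, -, ⟨u, hu⟩, hne⟩ := key Finset.univ
  refine ⟨u, (hOW hu).1, ?_⟩
  rw [hsf.fiberNorm_eq _ (hOW hu).2]
  exact Finset.prod_ne_zero_iff.mpr fun x hx => hne x hx u hu

/-- Lower bound for the number of points over a regular value: a polynomial of degree at most `d * K`
is determined by its Taylor expansions up to order `K` at these points. -/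
theorem choose_le_card_mul (hd : d ≠ 0) (hP : ∀ i, (P i).IsHomogeneous d)
    (h0 : ∀ x, polyMap P x = 0 → x = 0) (hW : IsRegularBase P W) {v : ι → ℂ} (hv : v ∈ W)
    (hk : Nat.card (polyMap P ⁻¹' {v}) ≠ 0) (K : ℕ) :
    (d * K + Fintype.card ι).choose (Fintype.card ι) ≤
      Nat.card (polyMap P ⁻¹' {v}) * (K + Fintype.card ι).choose (Fintype.card ι) := by
  classical
  have hfin : (polyMap P ⁻¹' {v}).Finite :=
    (exists_branches hd hP h0 (hW.nondegenerate_of_eq hv)).1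
  have := hfin.fintype
  let J : Set (ι →₀ ℕ) := {α | (α.sum fun _ e => e) ≤ K}
  have hJcard : Nat.card J = (K + Fintype.card ι).choose (Fintype.card ι) := by
    rw [← finrank_restrictTotalDegree, restrictTotalDegree,
      Module.finrank_eq_nat_card_basis (basisRestrictSupport ℂ _)]
  have hJne : Nat.card J ≠ 0 := by
    rw [hJcard]
    exact (Nat.choose_pos (Nat.le_add_left _ _)).ne'
  have : Finite J := Nat.finite_of_card_ne_zero hJne
  have := Fintype.ofFinite J
  let T : restrictTotalDegree ι ℂ (d * K) →ₗ[ℂ] (polyMap P ⁻¹' {v} → J → ℂ) :=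
    LinearMap.pi fun x => LinearMap.pi fun α =>
      lcoeff ℂ α.1 ∘ₗ (translate x.1).toLinearMap ∘ₗ Submodule.subtype _
  have hinj : Function.Injective T := by
    rw [← LinearMap.ker_eq_bot, LinearMap.ker_eq_bot']
    intro a haT
    by_contra hne
    obtain ⟨v', hv', hnorm⟩ := exists_fiberNorm_ne_zero hd hP h0 hW hv
      (a := a.1) fun h => hne (Subtype.ext h)
    refine hnorm (fiberNorm_eq_zero hd hP h0 hW hv hv' hk
      ((mem_restrictTotalDegree _ _ _).mp a.2) fun x hx α hα => ?_)
    by_contra hlt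
    have hα' : α ∈ J := by
      simp only [J, Set.mem_ofPred_eq]
      omega
    exact (mem_support_iff.mp hα) (congrFun (congrFun haT ⟨x, hx⟩) ⟨α, hα'⟩)
  have hle := LinearMap.finrank_le_finrank_of_injective hinj
  rw [finrank_restrictTotalDegree, Module.finrank_pi_fintype] at hle
  simp only [Module.finrank_fintype_fun_eq_card, Finset.sum_const, Finset.card_univ,
    smul_eq_mul] at hle
  rwa [← Nat.card_eq_fintype_card (α := J), hJcard,
    ← Nat.card_eq_fintype_card (α := polyMap P ⁻¹' {v})] at hle

/-- **Bézout's theorem** for a homogeneous polynomial map of degree `d` without nontrivial zeros. -/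
theorem card_fiber_polyMap (hd : d ≠ 0) (hP : ∀ i, (P i).IsHomogeneous d)
    (h0 : ∀ x, polyMap P x = 0 → x = 0) (hW : IsRegularBase P W)
    (hne : ∃ x, polyMap P x ∈ W) {v : ι → ℂ} (hv : v ∈ W) :
    Nat.card (polyMap P ⁻¹' {v}) = d ^ Fintype.card ι := by
  obtain ⟨x, hx⟩ := hne
  have hk : Nat.card (polyMap P ⁻¹' {v}) ≠ 0 := by
    rw [card_fiber_eq hd hP h0 hW hv hx]
    have hfin := (exists_branches hd hP h0 (hW.nondegenerate_of_eq hx)).1.to_subtype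
    have : Nonempty (polyMap P ⁻¹' {polyMap P x}) := ⟨⟨x, rfl⟩⟩
    exact Nat.card_pos.ne'
  refine le_antisymm ?_ (pow_le_of_choose_le (choose_le_card_mul hd hP h0 hW hv hk))
  obtain ⟨D, hD⟩ := card_mul_choose_le hd hP h0 (hW.nondegenerate_of_eq hv)
  exact le_pow_of_choose_le hD

end MvPoly

open Polynomial

/-! ### Polynomials with prescribed critical points -/

section Primitive

variable {R S : Type*} [CommRing R] [Algebra ℂ R] [CommRing S] [Algebra ℂ S]

/-- The primitive of a polynomial with constant term `0`. -/
noncomputable def primitive (p : R[X]) : R[X] :=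
  p.sum fun k a => monomial (k + 1) (((k : ℂ) + 1)⁻¹ • a)

theorem coeff_primitive_zero (p : R[X]) : (primitive p).coeff 0 = 0 := by
  simp [primitive, Polynomial.sum, coeff_monomial]

theorem coeff_primitive_succ (p : R[X]) (k : ℕ) :
    (primitive p).coeff (k + 1) = ((k : ℂ) + 1)⁻¹ • p.coeff k := by
  rw [primitive, Polynomial.sum, finsetSum_coeff]
  simp only [coeff_monomial, Nat.add_right_cancel_iff]
  rw [Finset.sum_ite_eq']
  split_ifs with h
  · rfl
  · rw [notMem_support_iff.mp h, smul_zero]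

theorem derivative_primitive (p : R[X]) : derivative (primitive p) = p := by
  ext k
  have hk : ((k : ℂ) + 1) ≠ 0 := Nat.cast_add_one_ne_zero k
  rw [coeff_derivative, coeff_primitive_succ]
  have : ((k : R) + 1) = algebraMap ℂ R (k + 1) := by simp
  rw [this, ← Algebra.commutes, ← Algebra.smul_def, smul_smul, mul_inv_cancel₀ hk, one_smul]

theorem primitive_derivative {p : R[X]} (h0 : p.coeff 0 = 0) : primitive (derivative p) = p := by
  ext k
  rcases k with _ | k
  · rw [coeff_primitive_zero, h0]
  · have hk : ((k : ℂ) + 1) ≠ 0 := Nat.cast_add_one_ne_zero k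
    rw [coeff_primitive_succ, coeff_derivative]
    have : ((k : R) + 1) = algebraMap ℂ R (k + 1) := by simp
    rw [this, ← Algebra.commutes, ← Algebra.smul_def, smul_smul, inv_mul_cancel₀ hk, one_smul]

theorem map_primitive (f : R →ₐ[ℂ] S) (p : R[X]) :
    (primitive p).map f.toRingHom = primitive (p.map f.toRingHom) := by
  ext k
  rcases k with _ | k
  · simp [coeff_primitive_zero]
  · simp [coeff_primitive_succ]

theorem natDegree_primitive_le (p : R[X]) : (primitive p).natDegree ≤ p.natDegree + 1 := by
  rw [natDegree_le_iff_coeff_eq_zero]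
  rintro (_ | k) hk
  · omega
  · rw [coeff_primitive_succ, coeff_eq_zero_of_natDegree_lt (by omega), smul_zero]

theorem primitive_sum {κ : Type*} (s : Finset κ) (p : κ → R[X]) :
    primitive (∑ j ∈ s, p j) = ∑ j ∈ s, primitive (p j) := by
  ext k
  rcases k with _ | k
  · simp [coeff_primitive_zero]
  · simp [coeff_primitive_succ, Finset.smul_sum]

theorem primitive_C_mul (r : R) (p : R[X]) : primitive (C r * p) = C r * primitive p := by
  ext k
  rcases k with _ | k
  · simp [coeff_primitive_zero]
  · simp [coeff_primitive_succ]

end Primitive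

section CritPoly

variable {ι : Type*} [Fintype ι] {R S : Type*} [CommRing R] [Algebra ℂ R] [CommRing S]
  [Algebra ℂ S]

/-- The monic polynomial `f` with constant term `0` and critical points `c`, that is,
`f' = n * ∏ l, (X - c l)` with `n = card ι + 1`. -/
noncomputable def critPoly (c : ι → R) : R[X] :=
  primitive (C ((Fintype.card ι : R) + 1) * ∏ l, (X - C (c l)))

theorem derivative_critPoly (c : ι → R) :
    derivative (critPoly c) = C ((Fintype.card ι : R) + 1) * ∏ l, (X - C (c l)) :=
  derivative_primitive _

theorem coeff_critPoly_zero (c : ι → R) : (critPoly c).coeff 0 = 0 := coeff_primitive_zero _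

theorem map_critPoly (f : R →ₐ[ℂ] S) (c : ι → R) :
    (critPoly c).map f.toRingHom = critPoly fun l => f (c l) := by
  rw [critPoly, map_primitive, critPoly]
  congr 1
  simp [Polynomial.map_prod]

theorem natDegree_critPoly_le (c : ι → R) : (critPoly c).natDegree ≤ Fintype.card ι + 1 := by
  refine (natDegree_primitive_le _).trans (Nat.add_le_add_right ?_ 1)
  refine (natDegree_C_mul_le _ _).trans ((natDegree_prod_le _ _).trans ?_)
  refine (Finset.sum_le_sum fun l _ => natDegree_X_sub_C_le (c l)).trans ?_
  simp

theorem monic_critPoly (c : ι → ℂ) : (critPoly c).Monic := by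
  refine monic_of_natDegree_le_of_coeff_eq_one _ (natDegree_critPoly_le c) ?_
  have h : (∏ l, (X - C (c l))).coeff (Fintype.card ι) = 1 := by
    have hm : (∏ l, (X - C (c l))).Monic := monic_prod_of_monic _ _ fun l _ => monic_X_sub_C _
    have hd : (∏ l, (X - C (c l))).natDegree = Fintype.card ι := by simp
    rw [← hd]
    exact hm.coeff_natDegree
  rw [critPoly, coeff_primitive_succ, coeff_C_mul, h, mul_one, smul_eq_mul,
    inv_mul_cancel₀ (Nat.cast_add_one_ne_zero _)]

theorem natDegree_critPoly (c : ι → ℂ) : (critPoly c).natDegree = Fintype.card ι + 1 := by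
  refine le_antisymm (natDegree_critPoly_le c) (Nat.lt_of_not_le fun h => ?_)
  have hd : (derivative (critPoly c)).natDegree = Fintype.card ι := by
    rw [derivative_critPoly, natDegree_C_mul (Nat.cast_add_one_ne_zero _)]
    simp
  have hlt : (derivative (critPoly c)).natDegree ≤ (critPoly c).natDegree - 1 :=
    natDegree_derivative_le _
  have h1 : (critPoly c).natDegree = 0 := by omega
  have h2 := (monic_critPoly c).natDegree_eq_zero.mp h1
  have h3 := coeff_critPoly_zero c
  rw [h2, coeff_one_zero] at h3
  exact one_ne_zero h3

theorem eval_critPoly_zero (c : ι → R) : (critPoly c).eval 0 = 0 := by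
  rw [← coeff_zero_eq_eval_zero, coeff_critPoly_zero]

theorem isRoot_derivative_critPoly (c : ι → ℂ) (z : ℂ) :
    (derivative (critPoly c)).IsRoot z ↔ z ∈ Set.range c := by
  have hN : ((Fintype.card ι : ℂ) + 1) ≠ 0 := Nat.cast_add_one_ne_zero _
  rw [derivative_critPoly, IsRoot.def, eval_mul, eval_C, mul_eq_zero, or_iff_right hN, eval_prod,
    Finset.prod_eq_zero_iff]
  simp only [Finset.mem_univ, true_and, eval_sub, eval_X, eval_C, sub_eq_zero, Set.mem_range]
  exact exists_congr fun _ => eq_comm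

theorem criticalValues_critPoly (c : ι → ℂ) :
    criticalValues (critPoly c) = Set.range fun i => (critPoly c).eval (c i) := by
  ext v
  simp only [criticalValues, Set.mem_image, Set.mem_ofPred_eq, isRoot_derivative_critPoly,
    Set.mem_range, exists_exists_eq_and]

/-! ### The critical value map -/

open MvPoly

/-- The critical value at the `i`-th critical point, as a polynomial in the critical points. -/
noncomputable def critValue (i : ι) : MvPolynomial ι ℂ :=
  (critPoly (MvPolynomial.X : ι → MvPolynomial ι ℂ)).eval (MvPolynomial.X i)

omit [Fintype ι] in
theorem eval_eval_critPoly (c : ι → ℂ) (p : (MvPolynomial ι ℂ)[X]) (q : MvPolynomial ι ℂ) :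
    MvPolynomial.eval c (p.eval q) =
      (p.map (MvPolynomial.aeval c : MvPolynomial ι ℂ →ₐ[ℂ] ℂ).toRingHom).eval
        (MvPolynomial.eval c q) := by
  rw [eval_map]
  exact (eval₂_at_apply (MvPolynomial.eval c) q).symm

theorem polyMap_critValue (c : ι → ℂ) (i : ι) :
    polyMap critValue c i = (critPoly c).eval (c i) := by
  rw [polyMap, critValue, eval_eval_critPoly, map_critPoly]
  simp

omit [Fintype ι] in
theorem isHomogeneous_coeff_prod (s : Finset ι) : ∀ k m : ℕ, k + m = s.card →
    ((∏ l ∈ s, (X - C (MvPolynomial.X l : MvPolynomial ι ℂ))).coeff k).IsHomogeneous m := by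
  classical
  induction s using Finset.induction_on with
  | empty =>
    intro k m h
    obtain ⟨rfl, rfl⟩ : k = 0 ∧ m = 0 := by simpa using h
    simpa using MvPolynomial.isHomogeneous_one ι ℂ
  | insert a s ha ih =>
    intro k m h
    rw [Finset.card_insert_of_notMem ha] at h
    rw [Finset.prod_insert ha, sub_mul, coeff_sub, coeff_C_mul]
    refine MvPolynomial.IsHomogeneous.sub ?_ ?_
    · rcases k with _ | k
      · simpa using MvPolynomial.isHomogeneous_zero ι ℂ m
      · rw [coeff_X_mul]
        exact ih k m (by omega)
    · rcases m with _ | m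
      · rw [coeff_eq_zero_of_natDegree_lt (n := k), mul_zero]
        · exact MvPolynomial.isHomogeneous_zero ι ℂ 0
        · rw [natDegree_prod_of_monic _ _ fun l _ => monic_X_sub_C _]
          simp only [natDegree_X_sub_C, Finset.sum_const, smul_eq_mul, mul_one]
          omega
      · rw [add_comm m 1]
        exact (MvPolynomial.isHomogeneous_X ℂ a).mul (ih k m (by omega))

theorem isHomogeneous_critValue (i : ι) :
    (critValue i).IsHomogeneous (Fintype.card ι + 1) := by
  rw [critValue, eval_eq_sum_range]
  refine MvPolynomial.IsHomogeneous.sum _ _ _ fun k hk => ?_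
  have hk := (Finset.mem_range_succ_iff.mp hk).trans (natDegree_critPoly_le _)
  rcases k with _ | k
  · rw [coeff_critPoly_zero, zero_mul]
    exact MvPolynomial.isHomogeneous_zero _ _ _
  · have h1 := isHomogeneous_coeff_prod (ι := ι) Finset.univ k (Fintype.card ι - k)
      (by rw [Finset.card_univ]; omega)
    have h2 : Fintype.card ι + 1 = (0 + (0 + (Fintype.card ι - k))) + 1 * (k + 1) := by omega
    have h3 : ((Fintype.card ι : MvPolynomial ι ℂ) + 1) =
        MvPolynomial.C ((Fintype.card ι : ℂ) + 1) := by
      simp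
    rw [critPoly, coeff_primitive_succ, coeff_C_mul, MvPolynomial.smul_eq_C_mul, h2, h3]
    exact ((MvPolynomial.isHomogeneous_C _ _).mul ((MvPolynomial.isHomogeneous_C _ _).mul h1)).mul
      ((MvPolynomial.isHomogeneous_X ℂ i).pow (k + 1))

/-- If all critical values are `0`, all `n - 1` critical points are roots of `f`, so that `f` has
`n - (n - 1) = 1` distinct roots. -/
theorem eq_zero_of_polyMap_critValue_eq_zero (c : ι → ℂ) (h : polyMap critValue c = 0) :
    c = 0 := by
  classical
  set f := critPoly c with hf
  have hf0 : f ≠ 0 := (monic_critPoly c).ne_zero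
  have hc : ∀ i, f.IsRoot (c i) := fun i => by
    rw [IsRoot.def, ← polyMap_critValue, h, Pi.zero_apply]
  have hN : ((Fintype.card ι : ℂ) + 1) ≠ 0 := Nat.cast_add_one_ne_zero _
  have hdc : (derivative f).roots.card = Fintype.card ι := by
    rw [IsAlgClosed.card_roots_eq_natDegree, derivative_critPoly, natDegree_C_mul hN]
    simp
  have hfc : f.roots.card = Fintype.card ι + 1 := by
    rw [IsAlgClosed.card_roots_eq_natDegree, natDegree_critPoly]
  have hsub : ∀ z ∈ (derivative f).roots, z ∈ f.roots.toFinset := fun z hz => by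
    obtain ⟨i, rfl⟩ := (isRoot_derivative_critPoly c z).mp (isRoot_of_mem_roots hz)
    rw [Multiset.mem_toFinset]
    exact (mem_roots hf0).mpr (hc i)
  have h1 : ∑ z ∈ f.roots.toFinset, (derivative f).roots.count z = Fintype.card ι := by
    rw [Multiset.sum_count_eq_card hsub, hdc]
  have h2 : ∑ z ∈ f.roots.toFinset, ((derivative f).roots.count z + 1) = Fintype.card ι + 1 := by
    rw [← hfc, ← Multiset.toFinset_sum_count_eq]
    refine Finset.sum_congr rfl fun z hz => ?_
    have hz := Multiset.mem_toFinset.mp hz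
    have hpos : 0 < f.roots.count z := Multiset.count_pos.mpr hz
    rw [count_roots] at hpos ⊢
    rw [count_roots, derivative_rootMultiplicity_of_root (isRoot_of_mem_roots hz)]
    omega
  have h3 : f.roots.toFinset.card = 1 := by
    rw [Finset.sum_add_distrib, h1, Finset.sum_const, smul_eq_mul, mul_one] at h2
    omega
  funext i
  refine Finset.card_le_one.mp h3.le _ ?_ 0 ?_
  · exact Multiset.mem_toFinset.mpr ((mem_roots hf0).mpr (hc i))
  · exact Multiset.mem_toFinset.mpr ((mem_roots hf0).mpr (eval_critPoly_zero c))

/-- Since `f' = 0` at the critical points, only the coefficients of `f` contribute to the partial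
derivatives of the critical values. -/
theorem eval_pderiv_critValue [DecidableEq ι] (c : ι → ℂ) (i j : ι) :
    MvPolynomial.eval c (MvPolynomial.pderiv j (critValue i)) =
      (primitive (C ((Fintype.card ι : ℂ) + 1) *
        -∏ l ∈ Finset.univ.erase j, (X - C (c l)))).eval (c i) := by
  let _ : Differential (MvPolynomial ι ℂ) := ⟨(MvPolynomial.pderiv j).restrictScalars ℤ⟩
  have hδ : ∀ p : MvPolynomial ι ℂ, Differential.deriv p = MvPolynomial.pderiv j p := fun _ => rfl
  let G : (MvPolynomial ι ℂ)[X] := ∏ l, (X - C (MvPolynomial.X l))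
  have hG : Differential.mapCoeffs G =
      -∏ l ∈ Finset.univ.erase j, (X - C (MvPolynomial.X l : MvPolynomial ι ℂ)) := by
    have hfac : ∀ l, Differential.mapCoeffs (X - C (MvPolynomial.X l : MvPolynomial ι ℂ)) =
        -C ((Pi.single l 1 : ι → MvPolynomial ι ℂ) j) := fun l => by
      rw [map_sub, Differential.mapCoeffs_X, Differential.mapCoeffs_C, hδ, MvPolynomial.pderiv_X,
        zero_sub, Pi.single_comm]
    have h0 : Differential.mapCoeffs
        (∏ l ∈ Finset.univ.erase j, (X - C (MvPolynomial.X l : MvPolynomial ι ℂ))) = 0 := by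
      refine Finset.prod_induction _ (fun p => Differential.mapCoeffs p = 0) ?_ ?_ ?_
      · intro p q hp hq
        rw [Derivation.leibniz, hp, hq, smul_zero, smul_zero, add_zero]
      · exact Derivation.map_one_eq_zero _
      · intro l hl
        rw [hfac, Pi.single_eq_of_ne (Finset.ne_of_mem_erase hl).symm, map_zero, neg_zero]
    rw [show G = _ from (Finset.mul_prod_erase _ _ (Finset.mem_univ j)).symm, Derivation.leibniz,
      h0, smul_zero, zero_add, hfac, Pi.single_eq_same, map_one, smul_neg, smul_eq_mul, mul_one]
  have hN : ∀ p : (MvPolynomial ι ℂ)[X],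
      Differential.mapCoeffs (C ((Fintype.card ι : MvPolynomial ι ℂ) + 1) * p) =
        C ((Fintype.card ι : MvPolynomial ι ℂ) + 1) * Differential.mapCoeffs p := fun p => by
    rw [Derivation.leibniz, Differential.mapCoeffs_C]
    simp
  have hprim : ∀ p : (MvPolynomial ι ℂ)[X],
      Differential.mapCoeffs (primitive p) = primitive (Differential.mapCoeffs p) := fun p => by
    ext1 k
    rcases k with _ | k
    · rw [Differential.coeff_mapCoeffs, coeff_primitive_zero, coeff_primitive_zero, map_zero]
    · rw [Differential.coeff_mapCoeffs, coeff_primitive_succ, coeff_primitive_succ,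
        Differential.coeff_mapCoeffs, hδ, hδ]
      exact (MvPolynomial.pderiv j).map_smul _ _
  have key : MvPolynomial.pderiv j (critValue i) =
      (primitive (C ((Fintype.card ι : MvPolynomial ι ℂ) + 1) *
        -∏ l ∈ Finset.univ.erase j, (X - C (MvPolynomial.X l)))).eval (MvPolynomial.X i) := by
    have h := Differential.deriv_aeval_eq (R := MvPolynomial ι ℂ) (MvPolynomial.X i)
      (critPoly (MvPolynomial.X : ι → MvPolynomial ι ℂ))
    have hz : (∏ l, (X - C (MvPolynomial.X l : MvPolynomial ι ℂ))).eval (MvPolynomial.X i) = 0 := by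
      rw [eval_prod]
      exact Finset.prod_eq_zero (Finset.mem_univ i) (by simp)
    rw [coe_aeval_eq_eval, derivative_critPoly, eval_mul, hz, mul_zero, zero_mul,
      add_zero] at h
    rw [← hδ, critValue, h, critPoly, hprim, hN, hG]
  rw [key, eval_eval_critPoly, map_primitive]
  congr 2
  · simp
  · simp [Polynomial.map_prod]

/-- A vector in the kernel of the Jacobian gives a polynomial of degree less than `n` that vanishes
at `0` and at the critical points. -/
theorem nondegenerate_critValue {c : ι → ℂ} (hinj : Function.Injective c) (h0 : ∀ i, c i ≠ 0) :
    Nondegenerate critValue c := by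
  classical
  intro h hh
  let N : ℂ := (Fintype.card ι : ℂ) + 1
  have hN : N ≠ 0 := Nat.cast_add_one_ne_zero _
  let g : ℂ[X] := ∑ j, C (h j) * (C N * -∏ l ∈ Finset.univ.erase j, (X - C (c l)))
  have hroot : ∀ i, (primitive g).eval (c i) = 0 := fun i => by
    rw [← hh i, primitive_sum, eval_finsetSum]
    refine Finset.sum_congr rfl fun j _ => ?_
    rw [primitive_C_mul, eval_mul, eval_C, eval_pderiv_critValue, mul_comm]
  have hdeg : (primitive g).natDegree ≤ Fintype.card ι := by
    rcases isEmpty_or_nonempty ι with hι | hι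
    · have : g = 0 := by simp [g]
      have h1 : primitive g = 0 := by simp [this, primitive]
      simp [h1]
    have hpos : 0 < Fintype.card ι := Fintype.card_pos
    refine (natDegree_primitive_le g).trans ?_
    suffices g.natDegree ≤ Fintype.card ι - 1 by omega
    refine natDegree_sum_le_of_forall_le _ _ fun j _ => ?_
    refine (natDegree_C_mul_le _ _).trans ((natDegree_C_mul_le _ _).trans ?_)
    rw [natDegree_neg, natDegree_prod_of_monic _ _ fun l _ => monic_X_sub_C _]
    simp [Finset.card_erase_of_mem]
  have hzero : primitive g = 0 := by
    refine eq_zero_of_natDegree_lt_card_of_eval_eq_zero' _ (insert 0 (Finset.univ.image c)) ?_ ?_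
    · intro z hz
      rcases Finset.mem_insert.mp hz with rfl | hz
      · rw [← coeff_zero_eq_eval_zero, coeff_primitive_zero]
      · obtain ⟨i, -, rfl⟩ := Finset.mem_image.mp hz
        exact hroot i
    · rw [Finset.card_insert_of_notMem, Finset.card_image_of_injective _ hinj, Finset.card_univ]
      · omega
      · simp [h0]
  have hg : g = 0 := by rw [← derivative_primitive g, hzero, derivative_zero]
  funext i
  have hi := congrArg (eval (c i)) hg
  rw [eval_finsetSum, Finset.sum_eq_single i] at hi
  · have hne : ∏ l ∈ Finset.univ.erase i, (c i - c l) ≠ 0 :=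
      Finset.prod_ne_zero_iff.mpr fun l hl =>
        sub_ne_zero.mpr fun h => Finset.ne_of_mem_erase hl (hinj h).symm
    simpa [eval_prod, hN, hne] using hi
  · intro j _ hji
    have hz : ∏ l ∈ Finset.univ.erase j, (c i - c l) = 0 :=
      Finset.prod_eq_zero (Finset.mem_erase.mpr ⟨hji.symm, Finset.mem_univ i⟩) (sub_self _)
    simp [eval_prod, hz]
  · exact fun h => (h (Finset.mem_univ i)).elim

end CritPoly

open MvPoly

/-! ### Configurations as regular values of the critical value map -/




section Config

variable (ι : Type*)

/-- Tuples of distinct non-zero complex numbers. -/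
def configSet : Set (ι → ℂ) := {w | Function.Injective w ∧ ∀ i, w i ≠ 0}

variable [Fintype ι]

theorem isOpen_configSet : IsOpen (configSet ι) := by
  have h : configSet ι = (⋂ i, ⋂ j, ⋂ _ : i ≠ j, {w : ι → ℂ | w i ≠ w j}) ∩
      ⋂ i, {w : ι → ℂ | w i ≠ 0} := by
    ext w
    simp only [configSet, Function.Injective, Set.mem_ofPred_eq, Set.mem_inter_iff, Set.mem_iInter]
    exact and_congr_left fun _ => ⟨fun h i j hij he => hij (h he),
      fun h i j he => by_contra fun hij => h i j hij he⟩
  rw [h]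
  refine (isOpen_iInter_of_finite fun i => isOpen_iInter_of_finite fun j =>
    isOpen_iInter_of_finite fun _ => ?_).inter (isOpen_iInter_of_finite fun i => ?_)
  · exact isOpen_ne_fun (continuous_apply i) (continuous_apply j)
  · exact isOpen_ne_fun (continuous_apply i) continuous_const

theorem finite_setOf_affine_eq_zero {α β : ℂ} (hα : α ≠ 0) : {s : ℂ | α + s * β = 0}.Finite := by
  rcases eq_or_ne β 0 with rfl | hβ
  · simp [hα]
  · refine (Set.finite_singleton (-α / β)).subset fun s hs => ?_
    have hs : α + s * β = 0 := hs
    rw [Set.mem_singleton_iff, eq_div_iff hβ]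
    linear_combination hs

/-- On a line through a point of `configSet ι`, each of the finitely many coincidences to be avoided
is an affine equation in the parameter with at most one solution. -/
theorem isRegularBase_critValue : IsRegularBase (critValue (ι := ι)) (configSet ι) where
  isOpen := isOpen_configSet ι
  finite_line v hv v' _ := by
    refine Set.Finite.subset ((Set.finite_iUnion fun i => Set.finite_iUnion fun j =>
      Set.finite_iUnion fun hij : i ≠ j => finite_setOf_affine_eq_zero
        (α := v i - v j) (β := (v' - v) i - (v' - v) j)
        (sub_ne_zero.mpr fun h => hij (hv.1 h))).union
      (Set.finite_iUnion fun i => finite_setOf_affine_eq_zero (β := (v' - v) i) (hv.2 i))) ?_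
    intro s hs
    by_contra hcon
    simp only [Set.mem_union, Set.mem_iUnion, Set.mem_ofPred_eq, not_or, not_exists] at hcon
    refine hs ⟨fun i j hij => by_contra fun hne => hcon.1 i j hne ?_, fun i hi => hcon.2 i ?_⟩
    · simp only [Pi.add_apply, Pi.smul_apply, smul_eq_mul] at hij
      linear_combination hij
    · simpa using hi
  nondegenerate c hc := by
    refine nondegenerate_critValue (fun i j hij => hc.1 ?_) fun i hi => hc.2 i ?_
    · rw [polyMap_critValue, polyMap_critValue, hij]
    · rw [polyMap_critValue, hi, eval_critPoly_zero]

/-- At the `i`-th unit vector, the `i`-th critical value is non-zero and all others vanish. Hence the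
polynomials that have to be non-zero at the required point are not the zero polynomial. -/
theorem exists_polyMap_critValue_mem : ∃ c, polyMap (critValue (ι := ι)) c ∈ configSet ι := by
  classical
  have hne : ∀ i : ι, (critPoly (Pi.single i 1 : ι → ℂ)).eval 1 ≠ 0 := fun i h1 => by
    set c : ι → ℂ := Pi.single i 1 with hc
    have hci : c i = 1 := Pi.single_eq_same i 1
    have h : polyMap critValue c = 0 := by
      funext j
      rw [polyMap_critValue, Pi.zero_apply]
      rcases eq_or_ne j i with rfl | hj
      · rwa [hci]
      · rw [hc, Pi.single_eq_of_ne hj, eval_critPoly_zero]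
    have := congrFun (eq_zero_of_polyMap_critValue_eq_zero c h) i
    rw [hci] at this
    exact one_ne_zero this
  have hself : ∀ i : ι, MvPolynomial.eval (Pi.single i 1) (critValue i) ≠ 0 := fun i => by
    have := polyMap_critValue (Pi.single i 1 : ι → ℂ) i
    rw [polyMap, Pi.single_eq_same] at this
    rw [this]
    exact hne i
  have hother : ∀ i j : ι, j ≠ i → MvPolynomial.eval (Pi.single i 1) (critValue j) = 0 :=
    fun i j hj => by
      have := polyMap_critValue (Pi.single i 1 : ι → ℂ) j
      rwa [polyMap, Pi.single_eq_of_ne hj, eval_critPoly_zero] at this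
  let Q : MvPolynomial ι ℂ := (∏ i, critValue i) *
    ∏ p ∈ Finset.univ.offDiag, (critValue p.1 - critValue p.2)
  have hQ : Q ≠ 0 := by
    refine mul_ne_zero (Finset.prod_ne_zero_iff.mpr fun i _ h => hself i (by rw [h, map_zero]))
      (Finset.prod_ne_zero_iff.mpr fun p hp h => hself p.1 ?_)
    rw [sub_eq_zero.mp h, hother p.1 p.2 (Finset.mem_offDiag.mp hp).2.2.symm]
  obtain ⟨c, hc⟩ : ∃ c, MvPolynomial.eval c Q ≠ 0 := by
    by_contra! h
    exact hQ (MvPolynomial.funext fun c => by rw [h, map_zero])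
  simp only [Q, map_mul, MvPolynomial.eval_prod, map_sub] at hc
  refine ⟨c, fun i j hij => by_contra fun hne => ?_, fun i hi => ?_⟩
  · exact right_ne_zero_of_mul hc (Finset.prod_eq_zero (i := (i, j)) (by simpa using hne)
      (sub_eq_zero.mpr hij))
  · exact left_ne_zero_of_mul hc (Finset.prod_eq_zero (Finset.mem_univ i) hi)

end Config

/-! ### The space of polynomials -/

theorem continuous_coeff (k : ℕ) : Continuous fun f : ℂ[X] => f.coeff k :=
  (continuous_apply k).comp continuous_induced_dom

theorem continuous_of_coeff {A : Type*} [TopologicalSpace A] {f : A → ℂ[X]}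
    (h : ∀ k, Continuous fun a => (f a).coeff k) : Continuous f :=
  continuous_induced_rng.mpr (continuous_pi h)

instance : T2Space ℂ[X] :=
  T2Space.of_injective_continuous (f := fun (f : ℂ[X]) (k : ℕ) => f.coeff k)
    (fun _ _ h => Polynomial.ext fun k => congrFun h k) continuous_induced_dom

instance : ContinuousMul ℂ[X] where
  continuous_mul := continuous_of_coeff fun k => by
    simp only [coeff_mul]
    exact continuous_finsetSum _ fun p _ => ((continuous_coeff p.1).comp continuous_fst).mul
      ((continuous_coeff p.2).comp continuous_snd)

section RootPoly

variable {ι : Type*} [Fintype ι]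

/-- The monic polynomial with roots `z`. -/
noncomputable def rootPoly (z : ι → ℂ) : ℂ[X] := ∏ i, (X - C (z i))

theorem monic_rootPoly (z : ι → ℂ) : (rootPoly z).Monic :=
  monic_prod_of_monic _ _ fun _ _ => monic_X_sub_C _

theorem natDegree_rootPoly (z : ι → ℂ) : (rootPoly z).natDegree = Fintype.card ι := by
  simp [rootPoly]

theorem isRoot_rootPoly {z : ι → ℂ} {x : ℂ} : (rootPoly z).IsRoot x ↔ x ∈ Set.range z := by
  simp only [rootPoly, IsRoot.def, eval_prod, Finset.prod_eq_zero_iff, Finset.mem_univ,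
    true_and, eval_sub, eval_X, eval_C, sub_eq_zero, Set.mem_range]
  exact exists_congr fun i => eq_comm

theorem continuous_rootPoly : Continuous (rootPoly : (ι → ℂ) → ℂ[X]) := by
  refine continuous_finsetProd _ fun _ _ => continuous_of_coeff fun k => ?_
  simp only [coeff_sub, coeff_C]
  split_ifs <;> fun_prop

/-- Cauchy's bound: the roots stay bounded if the coefficients do. -/
theorem isProperMap_rootPoly : IsProperMap (rootPoly : (ι → ℂ) → ℂ[X]) := by
  rw [isProperMap_iff_ultrafilter_of_t2]
  refine ⟨continuous_rootPoly, fun 𝒰 f hf => ?_⟩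
  let R : ℝ := ∑ k ∈ Finset.range (Fintype.card ι), (‖f.coeff k‖ + 1)
  have hR : ∀ k ∈ Finset.range (Fintype.card ι), ‖f.coeff k‖ + 1 ≤ R := fun k hk =>
    Finset.single_le_sum (f := fun k => ‖f.coeff k‖ + 1) (fun _ _ => by positivity) hk
  have hR0 : 0 ≤ R := Finset.sum_nonneg fun _ _ => by positivity
  have hev : ∀ᶠ z in (𝒰 : Filter (ι → ℂ)), ∀ k ∈ Finset.range (Fintype.card ι),
      ‖(rootPoly z).coeff k‖ < ‖f.coeff k‖ + 1 := by
    rw [Filter.eventually_all_finset]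
    intro k _
    exact (((continuous_coeff k).norm.tendsto f).comp hf).eventually_lt_const (lt_add_one _)
  have hmem : Metric.closedBall (0 : ι → ℂ) (R + 1) ∈ (𝒰 : Filter (ι → ℂ)) := by
    filter_upwards [hev] with z hz
    rw [mem_closedBall_zero_iff, pi_norm_le_iff_of_nonneg (by positivity)]
    intro i
    have h1 := (isRoot_rootPoly.mpr ⟨i, rfl⟩ : (rootPoly z).IsRoot (z i)).norm_lt_cauchyBound
      (monic_rootPoly z).ne_zero
    refine (NNReal.coe_le_coe.mpr h1.le).trans ?_
    rw [cauchyBound, (monic_rootPoly z).leadingCoeff, nnnorm_one, div_one, natDegree_rootPoly]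
    have h2 : (Finset.range (Fintype.card ι)).sup (fun k => ‖(rootPoly z).coeff k‖₊) ≤
        R.toNNReal := by
      refine Finset.sup_le fun k hk => ?_
      rw [← NNReal.coe_le_coe, Real.coe_toNNReal _ hR0, coe_nnnorm]
      exact (hz k hk).le.trans (hR k hk)
    have h3 := NNReal.coe_le_coe.mpr h2
    rw [Real.coe_toNNReal _ hR0] at h3
    rw [NNReal.coe_add, NNReal.coe_one]
    exact add_le_add_left h3 1
  obtain ⟨z, -, hz⟩ := (isCompact_closedBall (0 : ι → ℂ) (R + 1)).ultrafilter_le_nhds 𝒰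
    (le_principal_iff.mpr hmem)
  exact ⟨z, hz⟩

theorem exists_rootPoly_eq {N : ℕ} {f : ℂ[X]} (hm : f.Monic) (hd : f.natDegree = N) :
    ∃ z : Fin N → ℂ, rootPoly z = f := by
  have hcard : f.roots.toList.length = N := by
    rw [Multiset.length_toList, IsAlgClosed.card_roots_eq_natDegree, hd]
  subst hcard
  refine ⟨fun i => f.roots.toList[i.1], ?_⟩
  rw [rootPoly, Fin.prod_univ_fun_getElem f.roots.toList fun a => X - C a]
  have h := (IsAlgClosed.splits f).eq_prod_roots_of_monic hm
  conv_rhs => rw [h]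
  rw [← Multiset.prod_coe, ← Multiset.map_coe, Multiset.coe_toList]

theorem continuous_primitive : Continuous (primitive : ℂ[X] → ℂ[X]) := by
  refine continuous_of_coeff fun k => ?_
  rcases k with _ | k
  · simp only [coeff_primitive_zero]
    exact continuous_const
  · simp only [coeff_primitive_succ]
    exact (continuous_coeff k).const_smul ((k : ℂ) + 1)⁻¹

theorem continuous_derivative : Continuous (derivative : ℂ[X] → ℂ[X]) := by
  refine continuous_of_coeff fun k => ?_
  simp only [coeff_derivative]
  exact (continuous_coeff (k + 1)).mul_const _

theorem continuous_critPoly : Continuous (critPoly : (ι → ℂ) → ℂ[X]) :=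
  continuous_primitive.comp (continuous_const.mul continuous_rootPoly)

theorem isProperMap_critPoly : IsProperMap (critPoly : (ι → ℂ) → ℂ[X]) := by
  have hN : ((Fintype.card ι : ℂ) + 1) ≠ 0 := Nat.cast_add_one_ne_zero _
  refine isProperMap_of_comp_of_t2 continuous_critPoly
    (g := fun f => C ((Fintype.card ι : ℂ) + 1)⁻¹ * derivative f)
    (continuous_const.mul continuous_derivative) ?_
  have h : (fun f => C ((Fintype.card ι : ℂ) + 1)⁻¹ * derivative f) ∘
      (critPoly : (ι → ℂ) → ℂ[X]) = rootPoly := by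
    funext c
    rw [Function.comp_apply, derivative_critPoly, ← mul_assoc, ← C_mul, inv_mul_cancel₀ hN, C_1,
      one_mul, rootPoly]
  rw [h]
  exact isProperMap_rootPoly

theorem isProperMap_X_mul_rootPoly : IsProperMap fun z : ι → ℂ => X * rootPoly z := by
  refine isProperMap_of_comp_of_t2 (continuous_const.mul continuous_rootPoly) (g := divX)
    (continuous_of_coeff fun k => ?_) ?_
  · simp only [coeff_divX]
    exact continuous_coeff (k + 1)
  · have h : (divX ∘ fun z : ι → ℂ => X * rootPoly z) = rootPoly := by
      funext z
      ext k
      rw [Function.comp_apply, coeff_divX, coeff_X_mul]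
    rw [h]
    exact isProperMap_rootPoly

end RootPoly

/-- A proper map restricts to a closed, hence a quotient map onto any part of its range. -/
theorem continuous_of_isProperMap {A B Y : Type*} [TopologicalSpace A] [TopologicalSpace B]
    [TopologicalSpace Y] {κ : A → B} (hκ : IsProperMap κ) {T : Set B} (hT : ∀ b ∈ T, ∃ a, κ a = b)
    {φ : T → Y} (hφ : Continuous fun a : κ ⁻¹' T => φ ⟨κ a, a.2⟩) : Continuous φ := by
  have hq : IsQuotientMap (T.restrictPreimage κ) :=
    (hκ.isClosedMap.restrictPreimage T).isQuotientMap hκ.continuous.restrictPreimage (by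
      rintro ⟨b, hb⟩
      obtain ⟨a, rfl⟩ := hT b hb
      exact ⟨⟨a, hb⟩, rfl⟩)
  exact hq.continuous_iff.mpr hφ

/-! ### Unordered configurations -/

theorem exists_perm_of_range_eq {ι : Type*} {a b : ι → ℂ} (ha : Function.Injective a)
    (hb : Function.Injective b) (h : Set.range a = Set.range b) :
    ∃ σ : Equiv.Perm ι, b = a ∘ σ := by
  refine ⟨(Equiv.ofInjective b hb).trans
    ((Equiv.setCongr h.symm).trans (Equiv.ofInjective a ha).symm), ?_⟩
  funext i
  simp only [Function.comp_apply, Equiv.trans_apply]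
  rw [Equiv.apply_ofInjective_symm ha]
  rfl

/-- Near a tuple of distinct numbers, different tuples are not permutations of each other. -/
theorem exists_isOpen_perm_eq_one {ι : Type*} [Finite ι] {v : ι → ℂ} (hv : Function.Injective v) :
    ∃ O : Set (ι → ℂ), IsOpen O ∧ v ∈ O ∧
      ∀ (w : ι → ℂ) (σ : Equiv.Perm ι), w ∈ O → w ∘ σ ∈ O → σ = 1 := by
  obtain ⟨A, hA, hdisj⟩ := (Set.finite_range v).t2_separation
  refine ⟨Set.pi Set.univ fun i => A (v i), isOpen_set_pi Set.finite_univ fun i _ => (hA _).2,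
    fun i _ => (hA _).1, fun w σ hw hwσ => Equiv.ext fun i => ?_⟩
  by_contra hne
  have h1 := hw (σ i) (Set.mem_univ _)
  have h2 : w (σ i) ∈ A (v i) := hwσ i (Set.mem_univ _)
  exact Set.disjoint_left.mp (hdisj ⟨_, rfl⟩ ⟨_, rfl⟩ fun h => hne (hv h)) h1 h2

/-- A quotient map whose fibres are the orbits of a family of continuous maps is open. -/
theorem isOpenMap_of_orbits {A B κ : Type*} [TopologicalSpace A] [TopologicalSpace B] {q : A → B}
    (hq : IsQuotientMap q) {t : κ → A → A} (ht : ∀ k, Continuous (t k))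
    (h : ∀ a b, q a = q b ↔ ∃ k, t k a = b) : IsOpenMap q := by
  intro O hO
  rw [← hq.isOpen_preimage]
  have heq : q ⁻¹' (q '' O) = ⋃ k, t k ⁻¹' O := by
    ext a
    simp only [Set.mem_preimage, Set.mem_image, Set.mem_iUnion]
    constructor
    · rintro ⟨b, hb, hba⟩
      obtain ⟨k, rfl⟩ := (h a b).mp hba.symm
      exact ⟨k, hb⟩
    · rintro ⟨k, hk⟩
      exact ⟨t k a, hk, ((h a _).mpr ⟨k, rfl⟩).symm⟩
  rw [heq]
  exact isOpen_iUnion fun k => hO.preimage (ht k)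

theorem continuous_subtype_comp {ι : Type*} {p : (ι → ℂ) → Prop} (σ : ι → ι)
    (h : ∀ z : Subtype p, p (z.1 ∘ σ)) :
    Continuous fun z : Subtype p => (⟨z.1 ∘ σ, h z⟩ : Subtype p) :=
  Continuous.subtype_mk ((continuous_pi fun i => continuous_apply (σ i)).comp
    continuous_subtype_val) _

theorem isOpenMap_mkV (n : ℕ) : IsOpenMap (Quotient.mk (permV n)) := by
  refine isOpenMap_of_orbits (κ := Equiv.Perm (Fin (n - 1))) isQuotientMap_quot_mk
    (t := fun σ w => ⟨w.1 ∘ σ, w.2.1.comp σ.injective, fun i => w.2.2 _⟩)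
    (fun σ => continuous_subtype_comp σ _) fun a b => ?_
  rw [Quotient.eq]
  exact exists_congr fun σ => ⟨fun h => Subtype.ext h.symm, fun h => (congrArg Subtype.val h).symm⟩

theorem continuous_mkV (n : ℕ) : Continuous (Quotient.mk (permV n)) := continuous_quot_mk

/-- Local ordering of the points of a configuration. -/
theorem exists_ordering {n : ℕ} (v : OrdV n) {A : Set (Fin (n - 1) → ℂ)} (hA : IsOpen A)
    (hv : v.1 ∈ A) : ∃ U : Set (V n), IsOpen U ∧ Quotient.mk (permV n) v ∈ U ∧
      ∃ r : U → OrdV n, Continuous r ∧ ∀ y, (r y).1 ∈ A ∧ Quotient.mk (permV n) (r y) = y.1 := by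
  obtain ⟨O, hO, hvO, hperm⟩ := exists_isOpen_perm_eq_one v.2.1
  let B : Set (OrdV n) := Subtype.val ⁻¹' (O ∩ A)
  have hB : IsOpen B := (hO.inter hA).preimage continuous_subtype_val
  have hinj : Set.InjOn (Quotient.mk (permV n)) B := by
    intro a ha b hb hab
    obtain ⟨σ, hσ⟩ := Quotient.exact hab
    have h1 := hperm a.1 σ ha.1 (hσ ▸ hb.1)
    subst h1
    exact Subtype.ext hσ.symm
  obtain ⟨r, hr, hrB⟩ := exists_continuous_section (continuous_mkV n) (isOpenMap_mkV n) hB hinj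
  exact ⟨_, isOpenMap_mkV n B hB, ⟨v, ⟨hvO, hv⟩, rfl⟩, r, hr, fun y => ⟨(hrB y).1.2, (hrB y).2⟩⟩

/-! ### The covering by critical values -/

/-- Zero is not a critical value, so that all roots are simple. -/
theorem ncard_isRoot {f : ℂ[X]} (hf : f.Monic) (h0 : 0 ∉ criticalValues f) :
    {z : ℂ | f.IsRoot z}.ncard = f.natDegree := by
  classical
  have hnd : f.roots.Nodup := by
    rw [Multiset.nodup_iff_count_le_one]
    intro z
    rw [count_roots]
    by_contra! h
    obtain ⟨h1, h2⟩ := (one_lt_rootMultiplicity_iff_isRoot hf.ne_zero).mp h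
    exact h0 ⟨z, h2, h1⟩
  have hset : {z : ℂ | f.IsRoot z} = (f.roots.toFinset : Set ℂ) := by
    ext z
    simp [mem_roots hf.ne_zero]
  rw [hset, Set.ncard_coe_finset, Multiset.toFinset_card_of_nodup hnd,
    IsAlgClosed.card_roots_eq_natDegree]

section Theta

variable {n : ℕ}

theorem card_add_one (hn : 2 ≤ n) : Fintype.card (Fin (n - 1)) + 1 = n := by
  rw [Fintype.card_fin]
  omega

theorem criticalValues_eq_range (c : Fin (n - 1) → ℂ) :
    criticalValues (critPoly c) = Set.range (polyMap critValue c) := by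
  rw [criticalValues_critPoly]
  congr 1
  funext i
  exact (polyMap_critValue c i).symm

theorem critPoly_mem_polyZ (hn : 2 ≤ n) {c : Fin (n - 1) → ℂ} :
    critPoly c ∈ polyZ n ↔ polyMap critValue c ∈ configSet (Fin (n - 1)) := by
  have hd : (critPoly c).natDegree = n := (natDegree_critPoly c).trans (card_add_one hn)
  constructor
  · rintro ⟨-, -, hcard, h0⟩
    rw [criticalValues_eq_range] at hcard h0
    refine ⟨?_, fun i hi => h0 ⟨i, hi⟩⟩
    rw [← Set.image_univ] at hcard
    exact Set.injOn_univ.mp (Set.injOn_of_ncard_image_eq (by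
      rw [hcard, Set.ncard_univ, Nat.card_fin]))
  · rintro ⟨hinj, h0⟩
    have h0' : 0 ∉ criticalValues (critPoly c) := by
      rw [criticalValues_eq_range]
      rintro ⟨i, hi⟩
      exact h0 i hi
    refine ⟨⟨monic_critPoly c, hd, ?_⟩, coeff_critPoly_zero c, ?_, h0'⟩
    · rw [ncard_isRoot (monic_critPoly c) h0', hd]
    · rw [criticalValues_eq_range, ← Set.image_univ, Set.ncard_image_of_injective _ hinj,
        Set.ncard_univ, Nat.card_fin]

theorem theta_critPoly {c : Fin (n - 1) → ℂ} (hc : critPoly c ∈ polyZ n)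
    (hc' : polyMap critValue c ∈ configSet (Fin (n - 1))) :
    theta n ⟨critPoly c, hc⟩ = Quotient.mk (permV n) ⟨polyMap critValue c, hc'⟩ := by
  refine V.points_injective n ?_
  rw [theta_points, criticalValues_eq_range]
  rfl

theorem points_mk (w : OrdV n) : V.points (Quotient.mk (permV n) w) = Set.range w.1 := rfl

/-- An ordering of the critical values determines an ordering of the critical points. -/
theorem exists_critPoly_eq (hn : 2 ≤ n) {f : ℂ[X]} (hf : f ∈ polyZ n) {w : Fin (n - 1) → ℂ}
    (hw : Function.Injective w) (hwf : Set.range w = criticalValues f) :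
    ∃ c, critPoly c = f ∧ polyMap critValue c = w := by
  obtain ⟨⟨hm, hd, -⟩, h0, -, -⟩ := hf
  have hex : ∀ i, ∃ z, f.derivative.IsRoot z ∧ f.eval z = w i := fun i => by
    have : w i ∈ criticalValues f := hwf ▸ ⟨i, rfl⟩
    exact this
  choose c hc hcw using hex
  have hcinj : Function.Injective c := fun i j hij => hw (by rw [← hcw, ← hcw, hij])
  have hdeg : (derivative f).natDegree = n - 1 := by
    rw [natDegree_derivative, hd]
  have hd0 : derivative f ≠ 0 := fun h => by
    rw [h, natDegree_zero] at hdeg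
    omega
  have hroots : Finset.univ.val.map c = (derivative f).roots := by
    refine Multiset.eq_of_le_of_card_le ((Multiset.le_iff_subset
      ((Multiset.nodup_map_iff_of_injective hcinj).mpr Finset.univ.nodup)).mpr fun z hz => ?_) ?_
    · obtain ⟨i, -, rfl⟩ := Multiset.mem_map.mp hz
      exact (mem_roots hd0).mpr (hc i)
    · rw [IsAlgClosed.card_roots_eq_natDegree, hdeg]
      simp
  have hlead : (derivative f).leadingCoeff = (Fintype.card (Fin (n - 1)) : ℂ) + 1 := by
    have h1 : n - 1 + 1 = n := by omega
    rw [leadingCoeff, hdeg, coeff_derivative, h1]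
    nth_rewrite 1 [← hd]
    rw [hm.coeff_natDegree, Fintype.card_fin, one_mul]
  have hfac : derivative f = C ((Fintype.card (Fin (n - 1)) : ℂ) + 1) * ∏ l, (X - C (c l)) := by
    conv_lhs => rw [(IsAlgClosed.splits (derivative f)).eq_prod_roots, hlead, ← hroots,
      Multiset.map_map]
    rfl
  have hcrit : critPoly c = f := by
    rw [critPoly, ← hfac, primitive_derivative h0]
  refine ⟨c, hcrit, funext fun i => ?_⟩
  rw [polyMap_critValue, hcrit, hcw]

/-- The critical points are determined by the polynomial and by the order of the critical values. -/
theorem critPoly_injective {c c' : Fin (n - 1) → ℂ} (h : critPoly c = critPoly c')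
    (hF : polyMap critValue c = polyMap critValue c')
    (hinj : Function.Injective (polyMap critValue c)) : c = c' := by
  funext i
  obtain ⟨j, hj⟩ : c i ∈ Set.range c' := by
    rw [← isRoot_derivative_critPoly, ← h, isRoot_derivative_critPoly]
    exact ⟨i, rfl⟩
  have hij : polyMap critValue c i = polyMap critValue c j := by
    rw [polyMap_critValue c i, hF, polyMap_critValue c' j, hj, ← h]
  rw [← hj, hinj hij]

theorem continuous_theta (hn : 2 ≤ n) : Continuous (theta n) := by
  refine continuous_of_isProperMap (isProperMap_critPoly (ι := Fin (n - 1))) (fun f hf => ?_) ?_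
  · obtain ⟨v, hv⟩ := exists_points_eq hf
    obtain ⟨w, rfl⟩ := Quotient.exists_rep v
    obtain ⟨c, hc, -⟩ := exists_critPoly_eq hn hf w.2.1 hv
    exact ⟨c, hc⟩
  · have h : (fun c : (critPoly : (Fin (n - 1) → ℂ) → ℂ[X]) ⁻¹' polyZ n => theta n ⟨critPoly c.1, c.2⟩) = fun c =>
        Quotient.mk (permV n) ⟨polyMap critValue c.1, (critPoly_mem_polyZ hn).mp c.2⟩ :=
      funext fun c => theta_critPoly _ _
    rw [h]
    exact (continuous_mkV n).comp
      (Continuous.subtype_mk ((continuous_polyMap critValue).comp continuous_subtype_val) _)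

/-- The sheets of `theta` are the branches of the inverse of the critical value map, composed with a
local ordering of the critical values; their number is given by Bézout's theorem. -/
theorem exists_theta_sheets (hn : 2 ≤ n) (b : V n) : ∃ U : Set (V n), IsOpen U ∧ b ∈ U ∧
    ∃ (ι : Type) (s : ι → U → polyZ n), Nat.card ι = n ^ (n - 1) ∧
      IsSheetFamily (theta n) U s := by
  obtain ⟨v, rfl⟩ := Quotient.exists_rep b
  have hd : Fintype.card (Fin (n - 1)) + 1 ≠ 0 := Nat.succ_ne_zero _
  have hreg := isRegularBase_critValue (Fin (n - 1))
  obtain ⟨-, A, hA, hvA, s, -, -, hsc, -, hs⟩ := exists_branches hd isHomogeneous_critValue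
    eq_zero_of_polyMap_critValue_eq_zero (hreg.nondegenerate_of_eq v.2)
  obtain ⟨U, hU, hvU, r, hr, hrA⟩ := exists_ordering v hA hvA
  have hF : ∀ x (y : U), polyMap critValue (s x (r y).1) = (r y).1 :=
    fun x y => hs.apply x ⟨(r y).1, (hrA y).1⟩
  have hmem : ∀ x (y : U), critPoly (s x (r y).1) ∈ polyZ n := fun x y => by
    rw [critPoly_mem_polyZ hn, hF]
    exact (r y).2
  refine ⟨U, hU, hvU, polyMap critValue ⁻¹' {v.1}, fun x y => ⟨critPoly (s x (r y).1), hmem x y⟩,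
    ?_, ?_, ?_, ?_, ?_⟩
  · rw [card_fiber_polyMap hd isHomogeneous_critValue eq_zero_of_polyMap_critValue_eq_zero hreg
      (exists_polyMap_critValue_mem _) v.2, card_add_one hn, Fintype.card_fin]
  · intro x
    refine Continuous.subtype_mk (continuous_critPoly.comp ?_) _
    exact (hsc x).comp_continuous (continuous_subtype_val.comp hr) fun y => (hrA y).1
  · intro x y
    rw [theta_critPoly (hmem x y) (by rw [hF]; exact (r y).2), ← (hrA y).2]
    exact congrArg _ (Subtype.ext (hF x y))
  · intro y x x' hxx
    have h1 : critPoly (s x (r y).1) = critPoly (s x' (r y).1) := congrArg Subtype.val hxx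
    refine hs.injective ⟨(r y).1, (hrA y).1⟩ (critPoly_injective h1 ?_ ?_)
    · rw [hF, hF]
    · rw [hF]
      exact (r y).2.1
  · rintro ⟨f, hf⟩ hfU
    let y : U := ⟨theta n ⟨f, hf⟩, hfU⟩
    obtain ⟨c, hc, hcw⟩ := exists_critPoly_eq hn hf (r y).2.1 (by
      rw [← theta_points n ⟨f, hf⟩, ← points_mk, (hrA y).2])
    obtain ⟨x, hx⟩ := hs.exhaustive c (by rw [hcw]; exact (hrA y).1)
    refine ⟨x, Subtype.ext ?_⟩
    have hx : s x (polyMap critValue c) = c := hx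
    rw [hcw] at hx
    change critPoly (s x (r y).1) = f
    rw [hx, hc]

theorem isCoveringMapOfDegree_theta (hn : 2 ≤ n) :
    IsCoveringMapOfDegree (theta n) (n ^ (n - 1)) :=
  isCoveringMapOfDegree_of_sheets (continuous_theta hn) (pow_ne_zero _ (by omega))
    (exists_theta_sheets hn)

end Theta

/-! ### The tower -/

section Tower

variable {n : ℕ}

theorem toPoly_mk (w : OrdV n) : V.toPoly (Quotient.mk (permV n) w) = X * rootPoly w.1 := rfl

theorem isRoot_X_mul_rootPoly {ι : Type*} [Fintype ι] (w : ι → ℂ) (z : ℂ) :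
    (X * rootPoly w).IsRoot z ↔ z = 0 ∨ z ∈ Set.range w := by
  rw [← isRoot_rootPoly, IsRoot.def, eval_mul, eval_X, mul_eq_zero, IsRoot.def]

theorem toPoly_injective (n : ℕ) : Function.Injective (V.toPoly (n := n)) := by
  have h : ∀ v : V n, v.points = {z | z ≠ 0 ∧ v.toPoly.IsRoot z} := fun v => by
    obtain ⟨w, rfl⟩ := Quotient.exists_rep v
    rw [toPoly_mk, points_mk]
    ext z
    rw [Set.mem_ofPred_eq, isRoot_X_mul_rootPoly]
    constructor
    · rintro ⟨i, rfl⟩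
      exact ⟨w.2.2 i, Or.inr ⟨i, rfl⟩⟩
    · rintro ⟨h0, h | h⟩
      · exact (h0 h).elim
      · exact h
  intro v v' hv
  refine V.points_injective n ?_
  rw [h, h, hv]

theorem continuous_toPoly (n : ℕ) : Continuous (V.toPoly (n := n)) := by
  refine Continuous.quotient_lift (s := permV n) ?_ _
  exact continuous_const.mul (continuous_rootPoly.comp continuous_subtype_val)

theorem mem_configSet_of_mem_polyC (hn : 2 ≤ n) {w : Fin (n - 1) → ℂ}
    (h : X * rootPoly w ∈ polyC n) : w ∈ configSet (Fin (n - 1)) := by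
  have hset : {z : ℂ | (X * rootPoly w).IsRoot z} = insert 0 (Set.range w) := by
    ext z
    rw [Set.mem_ofPred_eq, isRoot_X_mul_rootPoly, Set.mem_insert_iff]
  have hcard := h.2.2
  rw [hset] at hcard
  have hle : (Set.range w).ncard ≤ n - 1 := by
    have := Set.ncard_image_le (f := w) (Set.finite_univ)
    rwa [Set.image_univ, Set.ncard_univ, Nat.card_fin] at this
  have h0 : 0 ∉ Set.range w := fun h0 => by
    rw [Set.insert_eq_of_mem h0] at hcard
    omega
  rw [Set.ncard_insert_of_notMem h0 (Set.finite_range w)] at hcard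
  refine ⟨Set.injOn_univ.mp (Set.injOn_of_ncard_image_eq ?_), fun i hi => h0 ⟨i, hi⟩⟩
  rw [Set.image_univ, Set.ncard_univ, Nat.card_fin]
  omega

theorem exists_X_mul_rootPoly_eq {b : ℂ[X]} (hb : b ∈ polyZ n) :
    ∃ w : Fin (n - 1) → ℂ, X * rootPoly w = b := by
  obtain ⟨⟨hm, hd, -⟩, h0, -, -⟩ := hb
  have hX : X * divX b = b := by
    have := X_mul_divX_add b
    rwa [h0, C_0, add_zero] at this
  have hm' : (divX b).Monic := by
    rw [← hX] at hm
    exact monic_X.of_mul_monic_left hm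
  obtain ⟨w, hw⟩ := exists_rootPoly_eq hm' (N := n - 1) (by rw [natDegree_divX_eq_natDegree_tsub_one, hd])
  exact ⟨w, by rw [hw, hX]⟩

theorem exists_toPoly_eq (hn : 2 ≤ n) {b : ℂ[X]} (hb : b ∈ polyZ n) : ∃ v : V n, v.toPoly = b := by
  obtain ⟨w, rfl⟩ := exists_X_mul_rootPoly_eq hb
  exact ⟨Quotient.mk (permV n) ⟨w, mem_configSet_of_mem_polyC hn hb.1⟩, rfl⟩

theorem towerZ_subset (n j : ℕ) : towerZ n j ⊆ polyZ n := by
  cases j with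
  | zero => exact subset_rfl
  | succ j => exact fun f hf => hf.1

theorem continuous_towerMap (hn : 2 ≤ n) (j : ℕ) : Continuous (towerMap n j) :=
  Continuous.subtype_mk ((continuous_toPoly n).comp ((continuous_theta hn).comp
    (Continuous.subtype_mk continuous_subtype_val _))) _

/-- The non-zero roots of a polynomial depend continuously on it. -/
theorem continuous_of_toPoly_eq (hn : 2 ≤ n) {T : Set ℂ[X]} (hT : T ⊆ polyZ n) {τ : T → V n}
    (hτ : ∀ b, (τ b).toPoly = b) : Continuous τ := by
  refine continuous_of_isProperMap (isProperMap_X_mul_rootPoly (ι := Fin (n - 1)))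
    (fun b hb => exists_X_mul_rootPoly_eq (hT hb)) ?_
  have hmem : ∀ w : (fun w : Fin (n - 1) → ℂ => X * rootPoly w) ⁻¹' T,
      w.1 ∈ configSet (Fin (n - 1)) := fun w => mem_configSet_of_mem_polyC hn (hT w.2).1
  let g : (fun w : Fin (n - 1) → ℂ => X * rootPoly w) ⁻¹' T → OrdV n := fun w => ⟨w.1, hmem w⟩
  have hg : Continuous g := Continuous.subtype_mk continuous_subtype_val _
  have h : (fun w : (fun w : Fin (n - 1) → ℂ => X * rootPoly w) ⁻¹' T =>
      τ ⟨X * rootPoly w.1, w.2⟩) = Quotient.mk (permV n) ∘ g :=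
    funext fun w => toPoly_injective n (hτ _)
  rw [h]
  exact (continuous_mkV n).comp hg

/-- Each map of the tower is the pullback of `theta` along the inverse of `V.toPoly`. -/
theorem isCoveringMapOfDegree_towerMap (hn : 2 ≤ n) (j : ℕ) :
    IsCoveringMapOfDegree (towerMap n j) (n ^ (n - 1)) := by
  refine isCoveringMapOfDegree_of_sheets (continuous_towerMap hn j)
    (pow_ne_zero _ (by omega)) fun b => ?_
  choose τ hτ using fun b : towerZ n j => exists_toPoly_eq hn (towerZ_subset n j b.2)
  have hτc : Continuous τ := continuous_of_toPoly_eq hn (towerZ_subset n j) hτ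
  obtain ⟨U, hU, hbU, ι, s, hι, hs⟩ := exists_theta_sheets hn (τ b)
  have hpoly : ∀ i (y : τ ⁻¹' U), (theta n (s i ⟨τ y.1, y.2⟩)).toPoly = y.1.1 := fun i y => by
    rw [hs.apply, hτ]
  refine ⟨τ ⁻¹' U, hU.preimage hτc, hbU, ι, fun i y => ⟨(s i ⟨τ y.1, y.2⟩).1,
    (s i ⟨τ y.1, y.2⟩).2, by rw [hpoly]; exact y.1.2⟩, hι, ?_, ?_, ?_, ?_⟩
  · intro i
    refine Continuous.subtype_mk (continuous_subtype_val.comp ((hs.continuous i).comp ?_)) _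
    exact Continuous.subtype_mk (hτc.comp continuous_subtype_val) _
  · exact fun i y => Subtype.ext (hpoly i y)
  · intro y i i' h
    exact hs.injective ⟨τ y.1, y.2⟩ (Subtype.ext (congrArg Subtype.val h :))
  · intro e he
    have hτe : τ (towerMap n j e) = theta n ⟨e.1, e.2.1⟩ := toPoly_injective n (hτ _)
    obtain ⟨i, hi⟩ := hs.exhaustive ⟨e.1, e.2.1⟩ (hτe ▸ he)
    refine ⟨i, Subtype.ext ?_⟩
    change (s i ⟨τ (towerMap n j e), he⟩).1 = e.1
    simp only [hτe]
    rw [hi]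

end Tower

/-! ### Forgetting the marked point -/

section Forget

variable {n : ℕ}

theorem continuous_mkD (n : ℕ) : Continuous (Quotient.mk (permD n)) := continuous_quot_mk

theorem permD_iff (hn : 0 < n) {z w : OrdD n} :
    permD n z w ↔ z.1 ⟨0, hn⟩ = w.1 ⟨0, hn⟩ ∧ Set.range z.1 = Set.range w.1 := by
  constructor
  · rintro ⟨σ, h0, h⟩
    rw [h, σ.surjective.range_comp, Function.comp_apply, h0 ⟨0, hn⟩ rfl]
    exact ⟨rfl, rfl⟩
  · rintro ⟨h0, h⟩
    obtain ⟨σ, hσ⟩ := exists_perm_of_range_eq z.2 w.2 h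
    refine ⟨σ, fun i hi => z.2 ?_, hσ⟩
    obtain rfl : i = ⟨0, hn⟩ := Fin.ext hi
    rw [h0, hσ, Function.comp_apply]

theorem rootPoly_eq_iff {ι : Type*} [Fintype ι] {z w : ι → ℂ} (hz : Function.Injective z)
    (hw : Function.Injective w) : rootPoly z = rootPoly w ↔ Set.range z = Set.range w := by
  constructor
  · intro h
    ext x
    rw [← isRoot_rootPoly, h, isRoot_rootPoly]
  · intro h
    obtain ⟨σ, rfl⟩ := exists_perm_of_range_eq hz hw h
    exact (Equiv.prod_comp σ fun i => X - C (z i)).symm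

theorem injective_of_rootPoly_mem {z : Fin n → ℂ} (h : rootPoly z ∈ polyC n) :
    Function.Injective z := by
  have hcard := h.2.2
  have hset : {x : ℂ | (rootPoly z).IsRoot x} = Set.range z := Set.ext fun x => isRoot_rootPoly
  rw [hset, ← Set.image_univ] at hcard
  exact Set.injOn_univ.mp (Set.injOn_of_ncard_image_eq (by
    rw [hcard, Set.ncard_univ, Nat.card_fin]))

/-- The polynomial with the given distinct roots. -/
noncomputable def ordPoly (z : OrdD n) : polyC n := ⟨rootPoly z.1, prod_mem_polyC z⟩

theorem forget_mk (z : OrdD n) : forget n (Quotient.mk (permD n) z) = ordPoly z := rfl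

theorem continuous_ordPoly : Continuous (ordPoly (n := n)) :=
  Continuous.subtype_mk (continuous_rootPoly.comp continuous_subtype_val) _

theorem ordPoly_surjective : Function.Surjective (ordPoly (n := n)) := by
  rintro ⟨f, hf⟩
  obtain ⟨z, rfl⟩ := exists_rootPoly_eq hf.1 hf.2.1
  exact ⟨⟨z, injective_of_rootPoly_mem hf⟩, rfl⟩

theorem isClosedMap_ordPoly : IsClosedMap (ordPoly (n := n)) := by
  intro A hA
  obtain ⟨A', hA', rfl⟩ := isClosed_induced_iff.mp hA
  have h : ordPoly '' (Subtype.val ⁻¹' A' : Set (OrdD n)) =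
      (Subtype.val ⁻¹' (rootPoly '' A') : Set (polyC n)) := by
    ext f
    constructor
    · rintro ⟨z, hz, rfl⟩
      exact ⟨z.1, hz, rfl⟩
    · rintro ⟨z, hz, hzf⟩
      exact ⟨⟨z, injective_of_rootPoly_mem (hzf ▸ f.2)⟩, hz, Subtype.ext hzf⟩
  rw [h]
  exact (isProperMap_rootPoly.isClosedMap A' hA').preimage continuous_subtype_val

theorem isOpenMap_ordPoly : IsOpenMap (ordPoly (n := n)) := by
  refine isOpenMap_of_orbits (κ := Equiv.Perm (Fin n))
    (isClosedMap_ordPoly.isQuotientMap continuous_ordPoly ordPoly_surjective)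
    (t := fun σ w => ⟨w.1 ∘ σ, w.2.comp σ.injective⟩)
    (fun σ => continuous_subtype_comp σ _) fun a b => ?_
  have h : ordPoly a = ordPoly b ↔ Set.range a.1 = Set.range b.1 :=
    Subtype.ext_iff.trans (rootPoly_eq_iff a.2 b.2)
  rw [h]
  constructor
  · intro hr
    obtain ⟨σ, hσ⟩ := exists_perm_of_range_eq a.2 b.2 hr
    exact ⟨σ, Subtype.ext hσ.symm⟩
  · rintro ⟨σ, rfl⟩
    exact (σ.surjective.range_comp _).symm

theorem continuous_forget (n : ℕ) : Continuous (forget n) :=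
  Continuous.quotient_lift (s := permD n) continuous_ordPoly _

/-- A point of `D n` is determined by its marked point and the polynomial with its points as roots,
both of which depend continuously on it. -/
theorem t2Space_D (hn : 0 < n) : T2Space (D n) := by
  let m : D n → ℂ := Quotient.lift (s := permD n) (fun z => z.1 ⟨0, hn⟩)
    fun _ _ h => ((permD_iff hn).mp h).1
  have hm : Continuous m := Continuous.quotient_lift (s := permD n)
    ((continuous_apply _).comp continuous_subtype_val) _
  refine T2Space.of_injective_continuous (f := fun z => (m z, (forget n z).1)) ?_
    (hm.prodMk (continuous_subtype_val.comp (continuous_forget n)))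
  intro a b hab
  obtain ⟨z, rfl⟩ := Quotient.exists_rep a
  obtain ⟨w, rfl⟩ := Quotient.exists_rep b
  have h1 : z.1 ⟨0, hn⟩ = w.1 ⟨0, hn⟩ := congrArg Prod.fst hab
  have h2 : rootPoly z.1 = rootPoly w.1 := congrArg Prod.snd hab
  exact Quotient.sound ((permD_iff hn).mpr ⟨h1, (rootPoly_eq_iff z.2 w.2).mp h2⟩)

/-- The sheets are given by a local ordering of the roots and the choice of one of them. -/
theorem isCoveringMapOfDegree_forget (hn : 0 < n) : IsCoveringMapOfDegree (forget n) n := by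
  have := t2Space_D hn
  refine isCoveringMapOfDegree_of_sheets (continuous_forget n) hn.ne' fun b => ?_
  obtain ⟨z, rfl⟩ := ordPoly_surjective b
  obtain ⟨O, hO, hzO, hperm⟩ := exists_isOpen_perm_eq_one z.2
  let B : Set (OrdD n) := Subtype.val ⁻¹' O
  have hB : IsOpen B := hO.preimage continuous_subtype_val
  have hinj : Set.InjOn (ordPoly (n := n)) B := by
    intro a ha b hb hab
    obtain ⟨σ, hσ⟩ := exists_perm_of_range_eq a.2 b.2
      ((rootPoly_eq_iff a.2 b.2).mp (congrArg Subtype.val hab))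
    have h1 := hperm a.1 σ ha (hσ ▸ hb)
    subst h1
    exact Subtype.ext hσ.symm
  obtain ⟨r, hr, hrB⟩ := exists_continuous_section continuous_ordPoly isOpenMap_ordPoly hB hinj
  let o : Fin n := ⟨0, hn⟩
  let t : Fin n → OrdD n → OrdD n := fun i z =>
    ⟨z.1 ∘ Equiv.swap o i, z.2.comp (Equiv.swap o i).injective⟩
  have ht : ∀ i, Continuous (t i) := fun i => continuous_subtype_comp (Equiv.swap o i) _
  have ht0 : ∀ i z, (t i z).1 o = z.1 i := fun i z => congrArg z.1 (Equiv.swap_apply_left o i)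
  have htr : ∀ i z, Set.range (t i z).1 = Set.range z.1 := fun i z =>
    (Equiv.swap o i).surjective.range_comp _
  refine ⟨ordPoly '' B, isOpenMap_ordPoly B hB, ⟨z, hzO, rfl⟩, Fin n,
    fun i y => Quotient.mk (permD n) (t i (r y)), Nat.card_fin n, ?_, ?_, ?_, ?_⟩
  · exact fun i => (continuous_mkD n).comp ((ht i).comp hr)
  · intro i y
    rw [forget_mk, ← (hrB y).2]
    exact Subtype.ext ((rootPoly_eq_iff (t i (r y)).2 (r y).2).mpr (htr _ _))
  · intro y i j hij
    have h := ((permD_iff hn).mp (Quotient.exact hij)).1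
    rw [ht0, ht0] at h
    exact (r y).2 h
  · intro e he
    obtain ⟨w, rfl⟩ := Quotient.exists_rep e
    let y : ordPoly '' B := ⟨ordPoly w, he⟩
    have hrange : Set.range (r y).1 = Set.range w.1 :=
      (rootPoly_eq_iff (r y).2 w.2).mp (congrArg Subtype.val (hrB y).2)
    obtain ⟨i, hi⟩ : w.1 o ∈ Set.range (r y).1 := hrange ▸ ⟨o, rfl⟩
    refine ⟨i, Quotient.sound ((permD_iff hn).mpr ⟨(ht0 i (r y)).trans hi, ?_⟩)⟩
    exact (htr i (r y)).trans hrange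

end Forget

/-! ### The homotopy equivalence -/

section Homotopy

variable {m : ℕ}

/-- The configuration of `0` and the points of `v`, with `0` marked. -/
def insertZero (v : OrdV (m + 1)) : OrdD (m + 1) :=
  ⟨Fin.cons (0 : ℂ) (v.1 : Fin m → ℂ), Fin.cons_injective_iff.mpr
    ⟨fun ⟨i, hi⟩ => v.2.2 i hi, v.2.1⟩⟩

/-- The positions of the other points relative to the marked one. -/
def relative (z : OrdD (m + 1)) : OrdV (m + 1) :=
  ⟨fun i : Fin m => z.1 i.succ - z.1 0,
    fun _ _ h => Fin.succ_injective m (z.2 (sub_left_injective h)),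
    fun i h => Fin.succ_ne_zero i (z.2 (sub_eq_zero.mp h))⟩

/-- The configuration translated by `-t` times its marked point. -/
noncomputable def translateD (p : OrdD (m + 1) × unitInterval) : OrdD (m + 1) :=
  ⟨fun i => p.1.1 i - ((p.2 : ℝ) : ℂ) * p.1.1 0, fun _ _ h => p.1.2 (sub_left_injective h)⟩

theorem continuous_insertZero : Continuous (insertZero (m := m)) := by
  refine Continuous.subtype_mk (continuous_pi fun i => ?_) _
  refine Fin.cases ?_ (fun i => ?_) i
  · simp only [Fin.cons_zero]
    exact continuous_const
  · simp only [Fin.cons_succ]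
    exact (continuous_apply i).comp continuous_subtype_val

theorem continuous_relative : Continuous (relative (m := m)) := by
  refine Continuous.subtype_mk (continuous_pi fun i => ?_) _
  exact ((continuous_apply _).comp continuous_subtype_val).sub
    ((continuous_apply _).comp continuous_subtype_val)

theorem continuous_translateD : Continuous (translateD (m := m)) := by
  refine Continuous.subtype_mk (continuous_pi fun i => ?_) _
  have h : ∀ j, Continuous fun p : OrdD (m + 1) × unitInterval => p.1.1 j := fun j =>
    (continuous_apply j).comp (continuous_subtype_val.comp continuous_fst)
  exact (h i).sub ((Complex.continuous_ofReal.comp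
    (continuous_subtype_val.comp continuous_snd)).mul (h 0))

theorem permV_iff {n : ℕ} {v w : OrdV n} : permV n v w ↔ Set.range v.1 = Set.range w.1 := by
  constructor
  · rintro ⟨σ, h⟩
    rw [h, σ.surjective.range_comp]
  · exact exists_perm_of_range_eq v.2.1 w.2.1

theorem insertZero_rel {v w : OrdV (m + 1)} (h : permV (m + 1) v w) :
    permD (m + 1) (insertZero v) (insertZero w) := by
  refine (permD_iff (Nat.succ_pos m)).mpr ⟨rfl, ?_⟩
  have hr := permV_iff.mp h
  exact (Fin.range_cons _ _).trans ((congrArg _ hr).trans (Fin.range_cons _ _).symm)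

theorem range_relative (z : OrdD (m + 1)) :
    Set.range (relative z).1 = {u | u ≠ 0 ∧ u + z.1 0 ∈ Set.range z.1} := by
  ext u
  constructor
  · rintro ⟨i, rfl⟩
    exact ⟨(relative z).2.2 i, ⟨Fin.succ i, (sub_add_cancel _ _).symm⟩⟩
  · rintro ⟨h0, i, hi⟩
    induction i using Fin.cases with
    | zero => exact (h0 (by simpa using hi)).elim
    | succ i => exact ⟨i, sub_eq_of_eq_add hi⟩

theorem relative_rel {z w : OrdD (m + 1)} (h : permD (m + 1) z w) :
    permV (m + 1) (relative z) (relative w) := by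
  obtain ⟨h0, hr⟩ := (permD_iff (Nat.succ_pos m)).mp h
  have h0 : z.1 0 = w.1 0 := h0
  rw [permV_iff, range_relative, range_relative, h0, hr]

theorem translateD_rel {z w : OrdD (m + 1)} (h : permD (m + 1) z w) (t : unitInterval) :
    permD (m + 1) (translateD (z, t)) (translateD (w, t)) := by
  obtain ⟨σ, h0, h⟩ := h
  refine ⟨σ, h0, funext fun i => ?_⟩
  change w.1 i - _ * w.1 0 = z.1 (σ i) - _ * z.1 0
  rw [h, Function.comp_apply, Function.comp_apply, h0 0 rfl]

theorem nonempty_homotopyEquiv (m : ℕ) :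
    Nonempty (ContinuousMap.HomotopyEquiv (V (m + 1)) (D (m + 1))) := by
  let f : V (m + 1) → D (m + 1) := Quotient.map (sa := permV (m + 1)) (sb := permD (m + 1))
    insertZero fun _ _ h => insertZero_rel h
  let g : D (m + 1) → V (m + 1) := Quotient.map (sa := permD (m + 1)) (sb := permV (m + 1))
    relative fun _ _ h => relative_rel h
  have hf : Continuous f := continuous_insertZero.quotient_map' _
  have hg : Continuous g := continuous_relative.quotient_map' _
  let H : D (m + 1) × unitInterval → D (m + 1) := fun p =>
    Quotient.map (sa := permD (m + 1)) (sb := permD (m + 1)) (fun z => translateD (z, p.2))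
      (fun _ _ h => translateD_rel h p.2) p.1
  -- An open quotient map stays a quotient map after taking the product with the unit interval.
  have hopen : IsOpenMap (Quotient.mk (permD (m + 1))) := by
    refine isOpenMap_of_orbits
      (κ := {σ : Equiv.Perm (Fin (m + 1)) // ∀ i : Fin (m + 1), i.val = 0 → σ i = i})
      isQuotientMap_quot_mk (t := fun σ w => ⟨w.1 ∘ σ.1, w.2.comp σ.1.injective⟩)
      (fun σ => continuous_subtype_comp σ.1 _) fun a b => ?_
    rw [Quotient.eq]
    exact ⟨fun ⟨σ, h0, h⟩ => ⟨⟨σ, h0⟩, Subtype.ext h.symm⟩,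
      fun ⟨σ, h⟩ => ⟨σ.1, σ.2, (congrArg Subtype.val h).symm⟩⟩
  have hq : IsQuotientMap (Prod.map (Quotient.mk (permD (m + 1))) (id : unitInterval → _)) :=
    (hopen.prodMap IsOpenMap.id).isQuotientMap ((continuous_mkD _).prodMap continuous_id)
      (Quotient.mk_surjective.prodMap Function.surjective_id)
  have hH : Continuous H := by
    refine hq.continuous_iff.mpr ?_
    exact (continuous_mkD _).comp continuous_translateD
  refine ⟨⟨⟨f, hf⟩, ⟨g, hg⟩, ?_, ?_⟩⟩
  · have hgf : (ContinuousMap.mk g hg).comp (ContinuousMap.mk f hf) = ContinuousMap.id _ := by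
      ext v
      obtain ⟨v, rfl⟩ := Quotient.exists_rep v
      refine congrArg (Quotient.mk (permV (m + 1))) (Subtype.ext (funext fun i => ?_))
      exact sub_zero _
    rw [hgf]
  · refine ContinuousMap.Homotopic.symm ⟨⟨⟨fun p => H (p.2, p.1), hH.comp continuous_swap⟩, ?_, ?_⟩⟩
    · intro z
      obtain ⟨z, rfl⟩ := Quotient.exists_rep z
      refine congrArg (Quotient.mk (permD (m + 1))) (Subtype.ext (funext fun i => ?_))
      simp [translateD]
    · intro z
      obtain ⟨z, rfl⟩ := Quotient.exists_rep z
      refine congrArg (Quotient.mk (permD (m + 1))) (Subtype.ext (funext fun i => ?_))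
      change z.1 i - ((1 : ℝ) : ℂ) * z.1 0 = _
      rw [Complex.ofReal_one, one_mul]
      refine Fin.cases ?_ (fun i => ?_) i
      · exact sub_self _
      · rfl

end Homotopy

end CriticalTower

theorem theorem1p2 (n : ℕ) (hn : 2 ≤ n) :
    -- the tower `⋯ → Z_n^{j+1} → Z_n^j → ⋯ → Z_n^2 → Z_n^1 = Z_n`
    (∀ j : ℕ, CriticalTower.IsCoveringMapOfDegree (CriticalTower.towerMap n j) (n ^ (n - 1))) ∧
    -- `θ_n : Z_n → V_n`
    CriticalTower.IsCoveringMapOfDegree (CriticalTower.theta n) (n ^ (n - 1)) ∧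
    -- `V_n ≃ D_n`
    Nonempty (ContinuousMap.HomotopyEquiv (CriticalTower.V n) (CriticalTower.D n)) ∧
    -- `p : D_n → C_n`
    CriticalTower.IsCoveringMapOfDegree (CriticalTower.forget n) n := by
  refine ⟨CriticalTower.isCoveringMapOfDegree_towerMap hn,
    CriticalTower.isCoveringMapOfDegree_theta hn, ?_,
    CriticalTower.isCoveringMapOfDegree_forget (by omega)⟩
  obtain ⟨m, rfl⟩ : ∃ m, n = m + 1 := ⟨n - 1, by omega⟩
  exact CriticalTower.nonempty_homotopyEquiv m
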